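/- **Setting.** Let $\rho,L,D>0$, let $\Omega\subset\mathbb R^d$ be nonempty, closed and convex with $\|x-y\|\le D$ for all $x,y\in\Omega$, and consider $\min_{x\in\Omega} f(x)$, $f(x)=\mathbb E_\xi[F(x,\xi)]$, where $f:\mathbb R^d\to\mathbb R$ is convex on $\Omega$ and differentiable at the points of $\Omega$ with $\|\nabla f(x)-\nabla f(y)\|\le L\|x-y\|$ for $x,y\in\Omega$. Let $x^*\in\Omega$ be a minimum point of $f$ over $\Omega$. All gradients of $F$ are in the first variable. *Procedure* $\mathrm{ICG}(g,u,\beta,\eta)$: put $u_1=u$; for $k=1,2,\dots$ call the linear minimization oracle (LMO) to get an optimal solution $v_k$ of $\max_{v\in\Omega}h_k(v)$, $h_k(v)=\langle g+\beta(u_k-u),u_k-v\rangle$; if $h_k(v_k)\le\eta$, stop and output $u_k$; otherwise put $u_{k+1}=(1-\alpha_k)u_k+\alpha_kv_k$ with $\alpha_k=\min\{1,\langle\beta(u-u_k)-g,v_k-u_k\rangle/(\beta\|v_k-u_k\|^2)\}$. *Stochastic conditional gradient sliding* with horizon $T$: start with $y_0=x_0\in\Omega$; for $t=1,\dots,T$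 put $z_t=(1-\gamma_t)x_{t-1}+\gamma_ty_{t-1}$, form a gradient estimate $g_t$ at $z_t$ from $b_t$ fresh i.i.d. samples that are independent of the past, and put $y_t=\mathrm{ICG}(g_t,y_{t-1},\beta_t,\eta_t)$, $x_t=(1-\gamma_t)x_{t-1}+\gamma_ty_t$. Throughout, $\beta_t=\frac{4L}{t+2}$, $\gamma_t=\frac3{t+2}$, $\eta_t=\frac{LD^2}{t(t+1)}$. **(a) First-order oracle.** Suppose that for every $x\in\Omega$ the stochastic gradient $\nabla F(x,\xi)$ satisfies $\mathbb E_\xi\nabla F(x,\xi)=\nabla f(x)$ and $\mathbb E_\xi\|\nabla F(x,\xi)-\nabla f(x)\|^2\le2\rho L[f(x)-f(x^*)]$. Let $b_t=\lceil3\rho t(t+1)\rceil$ and $g_t=\frac1{b_t}\sum_{i=1}^{b_t}\nabla F(z_t,\xi_{t,i})$. Then all calls of ICG terminate and, for $0\le t\le T$, $$\mathbb E[f(x_t)-f(x^*)]\le\frac{6LD^2}{(t+2)^2}+\frac{15LD^2+3\|\nabla f(x^*)\|D}{(t+1)(t+2)}.$$ Consequently, for every $\epsilon>0$ there is a horizon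 $T$ for which $\mathbb E[f(x_T)-f(x^*)]\le\epsilon$, the number $\sum_{t\le T}b_t$ of calls to the stochastic first-order oracle is at most $C\epsilon^{-1.5}$ and the total number of LMO calls is at most $C\epsilon^{-1}$, where $C$ depends only on $\rho,L,D$ and an upper bound on $\|\nabla f(x^*)\|$. **(b) Zeroth-order oracle.** Suppose that, almost surely in $\xi$, $F(\cdot,\xi)$ is differentiable on $\mathbb R^d$ with $L$-Lipschitz gradient, and that $\mathbb E_\xi\|\nabla F(x,\xi)\|^2\le2\rho L[f(x)-f(x^*)]$ for every $x\in\Omega$. Let $b_t=\lceil6\rho(d+4)t(t+1)\rceil$, $\nu=\frac{D}{(T+2)^2(d+6)^{3/2}}$ and $$g_t=\frac1{b_t}\sum_{j=1}^{b_t}\frac{F(z_t+\nu u_{t,j},\xi_{t,j})-F(z_t,\xi_{t,j})}{\nu}\,u_{t,j},$$ with $u_{t,j}\sim N(0,I_d)$ independent of $\xi_{t,j}$. Then all calls of ICG terminate and, for $0\le t\le T$, $$\mathbb E[f(x_t)-f(x^*)]\le\frac{8LD^2}{(t+2)^2}+\frac{32LD^2}{(t+1)(t+2)}.$$ Consequently,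 for every $\epsilon>0$ there is a horizon $T$, independent of $d$, such that for every $d\ge1$ one has $\mathbb E[f(x_T)-f(x^*)]\le\epsilon$, the number $2\sum_{t\le T}b_t$ of calls to the stochastic zeroth-order oracle is at most $Cd\,\epsilon^{-1.5}$ and the total number of LMO calls is at most $C\epsilon^{-1}$, where $C$ depends only on $\rho,L,D$. -/

import Mathlib

open MeasureTheory ProbabilityTheory
open scoped RealInnerProductSpace

universe u v

noncomputable section

/-! ### The stochastic optimization problem -/

/-- The objective `f(x) = 𝔼_ξ [F(x, ξ)]`, where `μ` is the law of `ξ`. -/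
def objective {d : ℕ} {Ξ : Type u} [MeasurableSpace Ξ]
    (F : EuclideanSpace ℝ (Fin d) → Ξ → ℝ) (μ : Measure Ξ) (x : EuclideanSpace ℝ (Fin d)) : ℝ :=
  ∫ ξ, F x ξ ∂μ

/-- The stochastic gradient `∇F(x, ξ)` (gradient in the first variable). -/
def stochGrad {d : ℕ} {Ξ : Type u} (F : EuclideanSpace ℝ (Fin d) → Ξ → ℝ)
    (x : EuclideanSpace ℝ (Fin d)) (ξ : Ξ) : EuclideanSpace ℝ (Fin d) :=
  gradient (fun y => F y ξ) x

/-- Minimize `f = 𝔼 F(·, ξ)` over a closed convex set `K` whose diameter is at most `D`; `f` is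
convex and has an `L`-Lipschitz gradient on `K`. -/
structure ConvexSmoothProblem {d : ℕ} {Ξ : Type u} [MeasurableSpace Ξ]
    (K : Set (EuclideanSpace ℝ (Fin d))) (F : EuclideanSpace ℝ (Fin d) → Ξ → ℝ) (μ : Measure Ξ)
    (L D : ℝ) : Prop where
  isClosed : IsClosed K
  convex : Convex ℝ K
  diam_le : ∀ x ∈ K, ∀ y ∈ K, ‖x - y‖ ≤ D
  measurable : Measurable (fun p : EuclideanSpace ℝ (Fin d) × Ξ => F p.1 p.2)
  integrable : ∀ x, Integrable (F x) μ
  convexOn : ConvexOn ℝ K (objective F μ)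
  differentiableAt : ∀ x ∈ K, DifferentiableAt ℝ (objective F μ) x
  lipschitz_grad : ∀ x ∈ K, ∀ y ∈ K,
    ‖gradient (objective F μ) x - gradient (objective F μ) y‖ ≤ L * ‖x - y‖

/-- `xs` is a minimum point of `f` over the feasible set `K`. -/
structure IsSolution {d : ℕ} {Ξ : Type u} [MeasurableSpace Ξ]
    (K : Set (EuclideanSpace ℝ (Fin d))) (F : EuclideanSpace ℝ (Fin d) → Ξ → ℝ) (μ : Measure Ξ)
    (xs : EuclideanSpace ℝ (Fin d)) : Prop where
  mem : xs ∈ K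
  le : ∀ x ∈ K, objective F μ xs ≤ objective F μ x

/-- The stochastic first-order oracle: for a query `x ∈ K` and a sample `ξ` it returns
`∇F(x, ξ)`, an unbiased estimator of `∇f(x)`. -/
structure IsFirstOrderOracle {d : ℕ} {Ξ : Type u} [MeasurableSpace Ξ]
    (K : Set (EuclideanSpace ℝ (Fin d))) (F : EuclideanSpace ℝ (Fin d) → Ξ → ℝ)
    (μ : Measure Ξ) : Prop where
  measurable : Measurable (fun p : EuclideanSpace ℝ (Fin d) × Ξ => stochGrad F p.1 p.2)
  differentiableAt : ∀ x ∈ K, ∀ᵐ ξ ∂μ, DifferentiableAt ℝ (fun y => F y ξ) x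
  integrable : ∀ x ∈ K, Integrable (stochGrad F x) μ
  unbiased : ∀ x ∈ K, ∫ ξ, stochGrad F x ξ ∂μ = gradient (objective F μ) x

/-- For almost every `ξ`, the function `F(·, ξ)` is differentiable on the whole space with an
`L`-Lipschitz gradient. -/
def SmoothSamples {d : ℕ} {Ξ : Type u} [MeasurableSpace Ξ]
    (F : EuclideanSpace ℝ (Fin d) → Ξ → ℝ) (μ : Measure Ξ) (L : ℝ) : Prop :=
  ∀ᵐ ξ ∂μ, Differentiable ℝ (fun y => F y ξ) ∧
    ∀ x y, ‖stochGrad F x ξ - stochGrad F y ξ‖ ≤ L * ‖x - y‖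

/-- Variance-based weak growth condition with constant `ρ`; the expectation on the left-hand side
is finite. -/
def VarianceWGC {d : ℕ} {Ξ : Type u} [MeasurableSpace Ξ]
    (K : Set (EuclideanSpace ℝ (Fin d))) (F : EuclideanSpace ℝ (Fin d) → Ξ → ℝ) (μ : Measure Ξ)
    (xs : EuclideanSpace ℝ (Fin d)) (L ρ : ℝ) : Prop :=
  ∀ x ∈ K, Integrable (fun ξ => ‖stochGrad F x ξ - gradient (objective F μ) x‖ ^ 2) μ ∧
    ∫ ξ, ‖stochGrad F x ξ - gradient (objective F μ) x‖ ^ 2 ∂μ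
      ≤ 2 * ρ * L * (objective F μ x - objective F μ xs)

/-- Moment-based weak growth condition with constant `ρ`; the expectation on the left-hand side
is finite. -/
def MomentWGC {d : ℕ} {Ξ : Type u} [MeasurableSpace Ξ]
    (K : Set (EuclideanSpace ℝ (Fin d))) (F : EuclideanSpace ℝ (Fin d) → Ξ → ℝ) (μ : Measure Ξ)
    (xs : EuclideanSpace ℝ (Fin d)) (L ρ : ℝ) : Prop :=
  ∀ x ∈ K, Integrable (fun ξ => ‖stochGrad F x ξ‖ ^ 2) μ ∧
    ∫ ξ, ‖stochGrad F x ξ‖ ^ 2 ∂μ ≤ 2 * ρ * L * (objective F μ x - objective F μ xs)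

/-- The one-sample Gaussian smoothing estimator `((F(x + ν u, ξ) - F(x, ξ)) / ν) u` on the sample
`(ξ, u)`. It makes two calls to the stochastic zeroth-order oracle. -/
def zerothOrderGrad {d : ℕ} {Ξ : Type u} (F : EuclideanSpace ℝ (Fin d) → Ξ → ℝ) (ν : ℝ)
    (x : EuclideanSpace ℝ (Fin d)) (q : Ξ × EuclideanSpace ℝ (Fin d)) :
    EuclideanSpace ℝ (Fin d) :=
  ((F (x + ν • q.2) q.1 - F x q.1) / ν) • q.2

/-! ### The inexact conditional gradient procedure `ICG(g, a, β, η)` -/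

/-- `h_k(s) = ⟨g + β (p_k - a), p_k - s⟩`, with `p = p_k` the current inner iterate. -/
def icgGap {d : ℕ} (g a : EuclideanSpace ℝ (Fin d)) (β : ℝ) (p s : EuclideanSpace ℝ (Fin d)) : ℝ :=
  ⟪g + β • (p - a), p - s⟫

/-- The inner step size, for the current inner iterate `p` and the LMO output `q`. -/
def icgStep {d : ℕ} (g a : EuclideanSpace ℝ (Fin d)) (β : ℝ) (p q : EuclideanSpace ℝ (Fin d)) : ℝ :=
  min 1 (⟪β • (a - p) - g, q - p⟫ / (β * ‖q - p‖ ^ 2))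

/-- `p 1, p 2, …` are the iterates and `q 1, q 2, …` the outputs of the linear minimization oracle
in an execution of `ICG(g, a, β, η)` over `K`. The oracle may return any optimal solution.
Nothing is required of `p k` and `q k` after the procedure has stopped. -/
structure IsICGExecution {d : ℕ} (K : Set (EuclideanSpace ℝ (Fin d)))
    (g a : EuclideanSpace ℝ (Fin d)) (β η : ℝ) (p q : ℕ → EuclideanSpace ℝ (Fin d)) : Prop where
  start : p 1 = a
  lmo : ∀ k, 1 ≤ k → (∀ j, 1 ≤ j → j < k → η < icgGap g a β (p j) (q j)) →
    q k ∈ K ∧ ∀ s ∈ K, icgGap g a β (p k) s ≤ icgGap g a β (p k) (q k)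
  step : ∀ k, 1 ≤ k → (∀ j, 1 ≤ j → j ≤ k → η < icgGap g a β (p j) (q j)) →
    p (k + 1) = (1 - icgStep g a β (p k) (q k)) • p k + icgStep g a β (p k) (q k) • q k

/-- The stopping test holds at some inner iteration. -/
def ICGTerminates {d : ℕ} (g a : EuclideanSpace ℝ (Fin d)) (β η : ℝ)
    (p q : ℕ → EuclideanSpace ℝ (Fin d)) : Prop :=
  ∃ k, 1 ≤ k ∧ icgGap g a β (p k) (q k) ≤ η

/-- The index of the inner iteration at which ICG stops. The oracle is called once per inner
iteration (the last one included), so this is also the number of calls to the linear minimization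
oracle. -/
def icgCalls {d : ℕ} (g a : EuclideanSpace ℝ (Fin d)) (β η : ℝ)
    (p q : ℕ → EuclideanSpace ℝ (Fin d)) : ℕ :=
  sInf {k | 1 ≤ k ∧ icgGap g a β (p k) (q k) ≤ η}

/-! ### Stochastic conditional gradient sliding -/

/-- A run of `T` outer iterations of stochastic conditional gradient sliding on a probability
space `(Ω, P)`. One gradient sample at the point `z` is `G z s`, where `s` has law `smp`. In
iteration `t` the samples `s t i`, `i : Fin (b t)`, are i.i.d. and independent of the past `ℱ (t - 1)`.
The sequences `p t` and `q t` are the inner iterates and LMO outputs of iteration `t`. -/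
structure IsSCGSRun {d : ℕ} {S : Type u} [MeasurableSpace S] {Ω : Type v} {mΩ : MeasurableSpace Ω}
    (K : Set (EuclideanSpace ℝ (Fin d)))
    (G : EuclideanSpace ℝ (Fin d) → S → EuclideanSpace ℝ (Fin d)) (smp : Measure S)
    (β γ η : ℕ → ℝ) (b : ℕ → ℕ) (T : ℕ) (P : Measure Ω) (ℱ : Filtration ℕ mΩ)
    (s : (t : ℕ) → Fin (b t) → Ω → S)
    (x y z g : ℕ → Ω → EuclideanSpace ℝ (Fin d))
    (p q : ℕ → ℕ → Ω → EuclideanSpace ℝ (Fin d)) : Prop where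
  init_x : ∃ x0 ∈ K, ∀ ω, x 0 ω = x0
  init_y : ∀ ω, y 0 ω = x 0 ω
  z_eq : ∀ t, 1 ≤ t → t ≤ T → ∀ ω, z t ω = (1 - γ t) • x (t - 1) ω + γ t • y (t - 1) ω
  g_eq : ∀ t, 1 ≤ t → t ≤ T → ∀ ω,
    g t ω = (b t : ℝ)⁻¹ • ∑ i : Fin (b t), G (z t ω) (s t i ω)
  icg : ∀ t, 1 ≤ t → t ≤ T → ∀ ω, IsICGExecution K (g t ω) (y (t - 1) ω) (β t) (η t)
    (fun k => p t k ω) (fun k => q t k ω)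
  y_eq : ∀ t, 1 ≤ t → t ≤ T → ∀ ω,
    y t ω = p t (icgCalls (g t ω) (y (t - 1) ω) (β t) (η t)
      (fun k => p t k ω) (fun k => q t k ω)) ω
  x_eq : ∀ t, 1 ≤ t → t ≤ T → ∀ ω, x t ω = (1 - γ t) • x (t - 1) ω + γ t • y t ω
  adapted : ∀ t, t ≤ T → Measurable[ℱ t] (y t)
  sample_measurable : ∀ t, 1 ≤ t → t ≤ T → ∀ i, Measurable (s t i)
  sample_dist : ∀ t, 1 ≤ t → t ≤ T → ∀ i, P.map (s t i) = smp
  sample_iIndep : ∀ t, 1 ≤ t → t ≤ T → iIndepFun (s t) P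
  sample_indep_past : ∀ t, 1 ≤ t → t ≤ T →
    Indep (ℱ (t - 1)) (MeasurableSpace.comap (fun ω i => s t i ω) MeasurableSpace.pi) P

/-- Every inner loop of the run stops, along the sample path `ω`. -/
def InnerLoopsTerminate {d : ℕ} {Ω : Type v} (β η : ℕ → ℝ) (T : ℕ)
    (y g : ℕ → Ω → EuclideanSpace ℝ (Fin d)) (p q : ℕ → ℕ → Ω → EuclideanSpace ℝ (Fin d))
    (ω : Ω) : Prop :=
  ∀ t, 1 ≤ t → t ≤ T → ICGTerminates (g t ω) (y (t - 1) ω) (β t) (η t)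
    (fun k => p t k ω) (fun k => q t k ω)

/-- The total number of calls to the linear minimization oracle along the sample path `ω`. -/
def lmoCalls {d : ℕ} {Ω : Type v} (β η : ℕ → ℝ) (T : ℕ)
    (y g : ℕ → Ω → EuclideanSpace ℝ (Fin d)) (p q : ℕ → ℕ → Ω → EuclideanSpace ℝ (Fin d))
    (ω : Ω) : ℕ :=
  ∑ t ∈ Finset.Icc 1 T, icgCalls (g t ω) (y (t - 1) ω) (β t) (η t)
    (fun k => p t k ω) (fun k => q t k ω)

/-- The total number of gradient samples in `T` outer iterations with batch sizes `b t`. -/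
def totalSamples (b : ℕ → ℕ) (T : ℕ) : ℕ := ∑ t ∈ Finset.Icc 1 T, b t

/-! ### The parameters -/

/-- `β_t = 4L / (t + 2)` -/
def scgsBeta (L : ℝ) (t : ℕ) : ℝ := 4 * L / (t + 2)

/-- `γ_t = 3 / (t + 2)` -/
def scgsGamma (t : ℕ) : ℝ := 3 / (t + 2)

/-- `η_t = L D² / (t (t + 1))` -/
def scgsEta (L D : ℝ) (t : ℕ) : ℝ := L * D ^ 2 / (t * (t + 1))

/-- First-order batch size `⌈3 ρ t (t + 1)⌉` -/
def batchFO (ρ : ℝ) (t : ℕ) : ℕ := ⌈3 * ρ * t * (t + 1)⌉₊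

/-- Zeroth-order batch size `⌈6 ρ (d + 4) t (t + 1)⌉` -/
def batchZO (ρ : ℝ) (d t : ℕ) : ℕ := ⌈6 * ρ * (d + 4) * t * (t + 1)⌉₊

/-- Smoothing parameter `ν = D / ((T + 2)² (d + 6)^(3/2))` -/
def smoothingParam (D : ℝ) (d T : ℕ) : ℝ := D / ((T + 2) ^ 2 * ((d : ℝ) + 6) ^ (3 / 2 : ℝ))

/-! ### The two settings -/

/-- A run of the first-order method with horizon `T` on a problem with the variance-based weak
growth condition. -/
structure FirstOrderSetting {d : ℕ} {Ξ : Type u} [MeasurableSpace Ξ] {Ω : Type v}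
    {mΩ : MeasurableSpace Ω} (ρ L D : ℝ) (K : Set (EuclideanSpace ℝ (Fin d)))
    (F : EuclideanSpace ℝ (Fin d) → Ξ → ℝ) (μ : Measure Ξ) (xs : EuclideanSpace ℝ (Fin d))
    (T : ℕ) (P : Measure Ω) (ℱ : Filtration ℕ mΩ) (s : (t : ℕ) → Fin (batchFO ρ t) → Ω → Ξ)
    (x y z g : ℕ → Ω → EuclideanSpace ℝ (Fin d))
    (p q : ℕ → ℕ → Ω → EuclideanSpace ℝ (Fin d)) : Prop where
  problem : ConvexSmoothProblem K F μ L D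
  solution : IsSolution K F μ xs
  oracle : IsFirstOrderOracle K F μ
  growth : VarianceWGC K F μ xs L ρ
  run : IsSCGSRun K (stochGrad F) μ (scgsBeta L) scgsGamma (scgsEta L D) (batchFO ρ) T P ℱ s
    x y z g p q

/-- A run of the zeroth-order method with horizon `T` on a problem with smooth samples and the
moment-based weak growth condition. A sample is a pair `(ξ, u)` with `ξ` and `u` independent,
`u` standard Gaussian. -/
structure ZerothOrderSetting {d : ℕ} {Ξ : Type u} [MeasurableSpace Ξ] {Ω : Type v}
    {mΩ : MeasurableSpace Ω} (ρ L D : ℝ) (K : Set (EuclideanSpace ℝ (Fin d)))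
    (F : EuclideanSpace ℝ (Fin d) → Ξ → ℝ) (μ : Measure Ξ) (xs : EuclideanSpace ℝ (Fin d))
    (T : ℕ) (P : Measure Ω) (ℱ : Filtration ℕ mΩ)
    (s : (t : ℕ) → Fin (batchZO ρ d t) → Ω → Ξ × EuclideanSpace ℝ (Fin d))
    (x y z g : ℕ → Ω → EuclideanSpace ℝ (Fin d))
    (p q : ℕ → ℕ → Ω → EuclideanSpace ℝ (Fin d)) : Prop where
  problem : ConvexSmoothProblem K F μ L D
  solution : IsSolution K F μ xs
  smooth : SmoothSamples F μ L
  growth : MomentWGC K F μ xs L ρ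
  run : IsSCGSRun K (zerothOrderGrad F (smoothingParam D d T))
    (μ.prod (stdGaussian (EuclideanSpace ℝ (Fin d))))
    (scgsBeta L) scgsGamma (scgsEta L D) (batchZO ρ d) T P ℱ s x y z g p q

end

/-! The argument has a deterministic layer, a probabilistic layer, and a solved scalar recursion.

Each inner loop is Frank-Wolfe with exact line search on a quadratic of curvature `β_t D²`. Its gap
falls below `η_t` after a number of steps proportional to `β_t D² / η_t ≤ 4t`
(`frankWolfe_gap_bound`, `scgsBeta_mul_sq_le`), so `T` outer iterations cost `O(T²)` oracle calls on
every sample path.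

One outer step is accelerated gradient descent with an inexact prox step (`sliding_step`).
Multiplied by `t(t+1)(t+2)`, the function gaps telescope. What remains is the LMO tolerance, a drift
of the distances `‖y_t - x*‖²`, the bias, and the noise. The samples are independent of the past, so
the linear noise term has mean zero and the quadratic one is a variance divided by `b_t`
(`batch_estimate`). Weak growth makes that variance proportional to the gap at `z_t`, and `b_t` of
order `t²` leaves only `(t+2) (f(z_t) - f(x*))` in the weighted inequality.

The decisive estimate is `gap_z_le`. It bounds the gap at `z_{t+1}` by a multiple of the gap at
`x_t` plus a term of order `L D² / t`. Smoothness bounds the gap at `y_t` by its linearization at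
`x*`, and since `x_t` contains `y_t` with weight `γ_t`, convexity and optimality bound that
linearization by the gap at `x_t`. So `‖∇f(x*)‖` enters the recursion only through its first step.
The potential then grows by a factor `1 + 2/(k(k+2))` plus a constant, and `weighted_recursion`
shows that it is `O(k)`, which is the `1/k²` rate.

For the zeroth-order oracle the same `IsSCGSRun.rate` applies. Gaussian smoothing differs from `⟪∇F,
u⟫ u` by a Taylor remainder of order `ν ‖u‖³`. Gaussian moments control its bias and show that the
second moment of the estimator grows linearly in `d` (`SmoothSamples.zerothOrderGrad_moments`). The
moment condition forces `∇f(x*) = 0`, so no gradient term survives. -/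

noncomputable section

/-! ### First-order convex analysis on a convex set -/

section Calculus

variable {E : Type*} [NormedAddCommGroup E] [InnerProductSpace ℝ E] [CompleteSpace E]

theorem hasDerivAt_comp_lineMap {f : E → ℝ} {x y : E} {s : ℝ}
    (hf : DifferentiableAt ℝ f (AffineMap.lineMap x y s)) :
    HasDerivAt (fun r : ℝ => f (AffineMap.lineMap x y r))
      ⟪gradient f (AffineMap.lineMap x y s), y - x⟫ s := by
  have h := hf.hasGradientAt.hasFDerivAt.comp_hasDerivAt s
    (AffineMap.hasDerivAt_lineMap (a := x) (b := y) (x := s))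
  rw [InnerProductSpace.toDual_apply_apply] at h
  exact h

/-- First-order characterization of convexity at a point of differentiability. -/
theorem ConvexOn.inner_gradient_le {K : Set E} {f : E → ℝ} (hf : ConvexOn ℝ K f) {x y : E}
    (hx : x ∈ K) (hy : y ∈ K) (hd : DifferentiableAt ℝ f x) :
    ⟪gradient f x, y - x⟫ ≤ f y - f x := by
  have hc := hf.comp_affineMap (AffineMap.lineMap x y : ℝ →ᵃ[ℝ] E)
  have h0 : DifferentiableAt ℝ f (AffineMap.lineMap x y (0 : ℝ)) := by simpa using hd
  have h := hc.le_slope_of_hasDerivAt (x := 0) (y := 1) (by simpa using hx) (by simpa using hy)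
    one_pos (hasDerivAt_comp_lineMap h0)
  simpa [slope_def_field] using h

/-- A Lipschitz gradient on a convex set gives the quadratic upper bound there. -/
theorem descent_on_convex {K : Set E} (hK : Convex ℝ K) {f : E → ℝ} {L : ℝ}
    (hd : ∀ x ∈ K, DifferentiableAt ℝ f x)
    (hlip : ∀ x ∈ K, ∀ y ∈ K, ‖gradient f x - gradient f y‖ ≤ L * ‖x - y‖)
    {x y : E} (hx : x ∈ K) (hy : y ∈ K) :
    f y ≤ f x + ⟪gradient f x, y - x⟫ + L / 2 * ‖y - x‖ ^ 2 := by
  set l : ℝ → E := fun r => AffineMap.lineMap x y r with hl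
  have hmem : ∀ s ∈ Set.Icc (0 : ℝ) 1, l s ∈ K := fun s hs =>
    hK.lineMap_mem hx hy hs
  -- `ψ` is the quadratic upper model minus `f` along the segment. Showing it monotone uses the
  -- gradient only at points of the segment, hence only in `K`.
  set ψ : ℝ → ℝ := fun s => s * ⟪gradient f x, y - x⟫ + L / 2 * ‖y - x‖ ^ 2 * s ^ 2 - f (l s)
    with hψ
  have hderiv : ∀ s ∈ Set.Icc (0 : ℝ) 1, HasDerivAt ψ
      (⟪gradient f x, y - x⟫ + L * ‖y - x‖ ^ 2 * s - ⟪gradient f (l s), y - x⟫) s := by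
    intro s hs
    have h1 := (hasDerivAt_id s).mul_const ⟪gradient f x, y - x⟫
    have h2 := ((hasDerivAt_id s).pow 2).const_mul (L / 2 * ‖y - x‖ ^ 2)
    have h3 := (h1.add h2).sub (hasDerivAt_comp_lineMap (hd _ (hmem s hs)))
    refine h3.congr_deriv ?_
    simp only [id, Nat.cast_ofNat, Nat.add_one_sub_one, pow_one, mul_one, one_mul, hl]
    ring
  have hmono : MonotoneOn ψ (Set.Icc 0 1) := by
    refine monotoneOn_of_deriv_nonneg (convex_Icc 0 1)
      (fun s hs => (hderiv s hs).continuousAt.continuousWithinAt)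
      (fun s hs => ((hderiv s (interior_subset hs)).differentiableAt).differentiableWithinAt) ?_
    intro s hs
    have hs' := interior_subset hs
    rw [(hderiv s hs').deriv]
    have hb := hlip _ (hmem s hs') x hx
    have hn : ‖l s - x‖ = s * ‖y - x‖ := by
      rw [hl]
      simp only [AffineMap.lineMap_apply_module']
      rw [add_sub_cancel_right, norm_smul, Real.norm_of_nonneg hs'.1]
    have hi := real_inner_le_norm (gradient f (l s) - gradient f x) (y - x)
    rw [inner_sub_left] at hi
    rw [hn] at hb
    nlinarith [mul_le_mul_of_nonneg_right hb (norm_nonneg (y - x))]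
  have h01 := hmono (Set.left_mem_Icc.2 zero_le_one) (Set.right_mem_Icc.2 zero_le_one) zero_le_one
  simp only [hψ, hl, AffineMap.lineMap_apply_zero, AffineMap.lineMap_apply_one] at h01
  linarith

/-- First-order optimality condition over a convex set, with a Lipschitz gradient. -/
theorem inner_gradient_nonneg_of_isMinOn {K : Set E} (hK : Convex ℝ K) {f : E → ℝ} {x y : E}
    (hd : DifferentiableAt ℝ f x) (hx : x ∈ K) (hy : y ∈ K) (hmin : ∀ w ∈ K, f x ≤ f w) :
    0 ≤ ⟪gradient f x, y - x⟫ := by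
  have h := (show IsMinOn f K x from hmin).localize.hasFDerivWithinAt_nonneg
    (hd.hasGradientAt.hasFDerivAt.hasFDerivWithinAt)
    (sub_mem_posTangentConeAt_of_segment_subset (hK.segment_subset hx hy))
  simpa using h

end Calculus

/-! ### Frank-Wolfe analysis of the inner loop -/

section InexactConditionalGradient

/-- A conditional gradient method cannot keep its gap above `η` during `4 * R` iterations, where
`C` is the curvature constant and `C ≤ η * R`. -/
theorem frankWolfe_gap_bound {e h : ℕ → ℝ} {C η : ℝ} {R : ℕ} (hR : 1 ≤ R)
    (hC : 0 ≤ C) (hCη : C ≤ η * R) (hη : 0 < η) (hlast : 0 ≤ e (4 * R + 1))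
    (hstep : ∀ k, 1 ≤ k → k ≤ 4 * R → ∀ α : ℝ, 0 ≤ α → α ≤ 1 →
      e (k + 1) ≤ e k - α * h k + C * α ^ 2 / 2)
    (hgap : ∀ k, 1 ≤ k → k ≤ 4 * R → e k ≤ h k) :
    ∃ k, 1 ≤ k ∧ k ≤ 4 * R ∧ h k ≤ η := by
  by_contra! hbig
  have hR' : (1 : ℝ) ≤ R := by exact_mod_cast hR
  -- The classical `O(1/k)` rate. The first step uses `α = 1`, which cancels `e 1` and so removes
  -- any dependence on the starting error; later steps use `α = 2/(k+2)`.
  have key : ∀ k : ℕ, 1 ≤ k → k ≤ 4 * R → e (k + 1) ≤ 2 * C / (k + 1) := by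
    intro k hk
    induction k, hk using Nat.le_induction with
    | base =>
      intro h1
      have h2 := hstep 1 le_rfl h1 1 zero_le_one le_rfl
      have h3 := hgap 1 le_rfl h1
      norm_num at h2 ⊢
      linarith
    | succ k hk ih =>
      intro hkN
      have ih' := ih (by omega)
      have hk0 : (0 : ℝ) < (k : ℝ) := by exact_mod_cast hk
      set α : ℝ := 2 / ((k : ℝ) + 2) with hα
      have hα0 : 0 ≤ α := by positivity
      have hα1 : α ≤ 1 := by rw [hα, div_le_one (by positivity)]; linarith
      have h2 := hstep (k + 1) (by omega) hkN α hα0 hα1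
      have h3 := hgap (k + 1) (by omega) hkN
      have h4 : e (k + 1 + 1) ≤ (1 - α) * (2 * C / (k + 1)) + C * α ^ 2 / 2 := by
        nlinarith [mul_le_mul_of_nonneg_left h3 hα0,
          mul_le_mul_of_nonneg_left ih' (sub_nonneg.2 hα1)]
      refine h4.trans ?_
      push_cast
      have : 2 * C / ((k : ℝ) + 1 + 1) - ((1 - α) * (2 * C / (k + 1)) + C * α ^ 2 / 2)
          = C * (2 / ((k + 1) * (k + 2) ^ 2)) := by
        rw [hα]; field_simp; ring
      have h5 : 0 ≤ C * (2 / (((k : ℝ) + 1) * (k + 2) ^ 2)) := by positivity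
      linarith
  -- By iteration `2R` the error is at most `C / R ≤ η`. From there each step with `α = 1/R` and gap
  -- above `η` gains at least `η/R - C/(2R²) ≥ η/(2R)`. The `2R + 1` steps that remain push the
  -- error below zero, a contradiction.
  have tail : ∀ n : ℕ, n ≤ 2 * R + 1 → e (2 * R + n) ≤ C / R - n * (η / (2 * R)) := by
    intro n
    induction n with
    | zero =>
      intro _
      have h1 := key (2 * R - 1) (by omega) (by omega)
      have h2 : 2 * R - 1 + 1 = 2 * R := by omega
      have h3 : (((2 * R - 1 : ℕ) : ℝ) + 1) = 2 * R := by
        rw [Nat.cast_sub (by omega)]; push_cast; ring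
      rw [h2, h3, mul_div_mul_left _ _ two_ne_zero] at h1
      simpa using h1
    | succ n ih =>
      intro hn
      have ih' := ih (by omega)
      have hin : (1 : ℝ) / R ≤ 1 := by rw [div_le_one (by positivity)]; exact hR'
      have h2 := hstep (2 * R + n) (by omega) (by omega) (1 / R) (by positivity) hin
      have h3 := hbig (2 * R + n) (by omega) (by omega)
      have h4 : C * (1 / (R : ℝ)) ^ 2 / 2 ≤ η / (2 * R) := by
        have : C * (1 / (R : ℝ)) ^ 2 / 2 ≤ η * R * (1 / (R : ℝ)) ^ 2 / 2 := by gcongr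
        refine this.trans (le_of_eq ?_)
        field_simp
      have h5 : 1 / (R : ℝ) * η ≤ 1 / (R : ℝ) * h (2 * R + n) := by gcongr
      have h6 : 1 / (R : ℝ) * η = η / (2 * R) + η / (2 * R) := by field_simp; ring
      rw [← add_assoc]
      push_cast
      linarith
  have h1 := tail (2 * R + 1) le_rfl
  rw [show 2 * R + (2 * R + 1) = 4 * R + 1 by ring] at h1
  have h7 : C / R ≤ η := by rw [div_le_iff₀ (by positivity)]; exact hCη
  have h8 : ((2 * R + 1 : ℕ) : ℝ) * (η / (2 * R)) = η + η / (2 * R) := by push_cast; field_simp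
  have h9 : 0 < η / (2 * R) := by positivity
  linarith

variable {d : ℕ} {K : Set (EuclideanSpace ℝ (Fin d))} {g a : EuclideanSpace ℝ (Fin d)}
  {β η D : ℝ} {p q : ℕ → EuclideanSpace ℝ (Fin d)}

theorem icgStep_mem {u w : EuclideanSpace ℝ (Fin d)} (hβ : 0 ≤ β)
    (hgap : 0 ≤ icgGap g a β u w) : 0 ≤ icgStep g a β u w ∧ icgStep g a β u w ≤ 1 := by
  have h : ⟪β • (a - u) - g, w - u⟫ = icgGap g a β u w := by
    rw [icgGap, ← inner_neg_neg]
    congr 1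
    · module
    · abel
  refine ⟨le_min zero_le_one ?_, min_le_left _ _⟩
  rw [h]
  positivity

/-- The objective of the ICG subproblem. -/
def icgModel (g a : EuclideanSpace ℝ (Fin d)) (β : ℝ) (u : EuclideanSpace ℝ (Fin d)) : ℝ :=
  ⟪g, u⟫ + β / 2 * ‖u - a‖ ^ 2

/-- The model is quadratic, so its second-order expansion along a segment is exact. The Frank-Wolfe
gap is minus the slope at `u`. -/
theorem icgModel_add_smul (u w : EuclideanSpace ℝ (Fin d)) (α : ℝ) :
    icgModel g a β ((1 - α) • u + α • w)
      = icgModel g a β u - α * icgGap g a β u w + β / 2 * α ^ 2 * ‖w - u‖ ^ 2 := by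
  have h1 : (1 - α) • u + α • w - a = (u - a) + α • (w - u) := by module
  have h2 : (1 - α) • u + α • w = u + α • (w - u) := by module
  have h3 : u - w = -(w - u) := by abel
  rw [icgModel, icgModel, icgGap, h1, h2, h3, norm_add_sq_real]
  simp only [inner_add_left, inner_add_right, inner_smul_right, inner_smul_left, inner_neg_right,
    norm_smul, mul_pow, Real.norm_eq_abs, sq_abs, RCLike.conj_to_real]
  ring

theorem icgModel_sub_le_gap (hβ : 0 ≤ β) (u w : EuclideanSpace ℝ (Fin d)) :
    icgModel g a β u - icgModel g a β w ≤ icgGap g a β u w := by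
  have h := icgModel_add_smul (g := g) (a := a) (β := β) u w 1
  simp only [sub_self, zero_smul, one_smul, zero_add] at h
  have : 0 ≤ β / 2 * 1 ^ 2 * ‖w - u‖ ^ 2 := by positivity
  linarith

/-- The inner step size minimizes the model along the segment. -/
theorem icgModel_step_le (hβ : 0 < β) (u w : EuclideanSpace ℝ (Fin d))
    (hgap : 0 ≤ icgGap g a β u w) {α : ℝ} (hα0 : 0 ≤ α) (hα1 : α ≤ 1) :
    icgModel g a β ((1 - icgStep g a β u w) • u + icgStep g a β u w • w)
      ≤ icgModel g a β u - α * icgGap g a β u w + β / 2 * α ^ 2 * ‖w - u‖ ^ 2 := by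
  rw [icgModel_add_smul]
  have h : ⟪β • (a - u) - g, w - u⟫ = icgGap g a β u w := by
    rw [icgGap, ← inner_neg_neg]
    congr 1
    · module
    · abel
  rcases eq_or_ne w u with rfl | hne
  · simp [icgGap]
  have hn : 0 < β * ‖w - u‖ ^ 2 := by
    have := norm_pos_iff.2 (sub_ne_zero.2 hne)
    positivity
  rw [icgStep, h]
  set H := icgGap g a β u w
  set Q := β * ‖w - u‖ ^ 2 with hQ
  have hH : H / Q * Q = H := div_mul_cancel₀ _ hn.ne'
  have expand : ∀ r : ℝ, β / 2 * r ^ 2 * ‖w - u‖ ^ 2 = r ^ 2 * Q / 2 := fun r => by rw [hQ]; ring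
  rw [expand, expand]
  -- The parabola `-α H + α² Q / 2` has its vertex at `H / Q`. If the vertex lies beyond `1` the
  -- clipped step is optimal on `[0, 1]`; otherwise the vertex itself is.
  rcases le_total 1 (H / Q) with h1 | h1
  · rw [min_eq_left h1]
    have : Q ≤ H := by nlinarith
    nlinarith [mul_nonneg (sub_nonneg.2 hα1) (sub_nonneg.2 this),
      mul_nonneg hn.le (sq_nonneg (1 - α))]
  · rw [min_eq_right h1]
    nlinarith [mul_nonneg hn.le (sq_nonneg (H / Q - α))]

namespace IsICGExecution

/-- Feasibility can be claimed only up to the stopping index, because iterates after it are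
unconstrained. -/
theorem mem (hK : Convex ℝ K) (hex : IsICGExecution K g a β η p q) (ha : a ∈ K) (hβ : 0 ≤ β)
    (hη : 0 ≤ η) {k : ℕ} (hk : 1 ≤ k)
    (hrun : ∀ j, 1 ≤ j → j < k → η < icgGap g a β (p j) (q j)) : p k ∈ K := by
  induction k, hk using Nat.le_induction with
  | base => rw [hex.start]; exact ha
  | succ k hk ih =>
    have hpk := ih fun j h1 h2 => hrun j h1 (by omega)
    have hstep := hex.step k hk fun j h1 h2 => hrun j h1 (by omega)
    have hqk := (hex.lmo k hk fun j h1 h2 => hrun j h1 (by omega)).1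
    have hα := icgStep_mem hβ (hη.trans (hrun k hk (by omega)).le)
    rw [hstep]
    exact hK hpk hqk (sub_nonneg.2 hα.2) hα.1 (by ring)

/-- The model has curvature at most `β D²` on `K`, and exact line search is at least as good as
every step size that `frankWolfe_gap_bound` wants to test. -/
theorem exists_gap_le (hK : Convex ℝ K) (hdiam : ∀ x ∈ K, ∀ y ∈ K, ‖x - y‖ ≤ D)
    (hex : IsICGExecution K g a β η p q) (ha : a ∈ K) (hβ : 0 < β) (hη : 0 < η) {R : ℕ}
    (hR : 1 ≤ R) (hβη : β * D ^ 2 ≤ η * R) :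
    ∃ k, 1 ≤ k ∧ k ≤ 4 * R ∧ icgGap g a β (p k) (q k) ≤ η := by
  by_contra! hrun
  have hmem : ∀ k, 1 ≤ k → k ≤ 4 * R + 1 → p k ∈ K := fun k h1 h2 =>
    hex.mem hK ha hβ.le hη.le h1 fun j h3 h4 => hrun j h3 (by omega)
  have hlmo : ∀ k, 1 ≤ k → k ≤ 4 * R →
      q k ∈ K ∧ ∀ s ∈ K, icgGap g a β (p k) s ≤ icgGap g a β (p k) (q k) := fun k h1 h2 =>
    hex.lmo k h1 fun j h3 h4 => hrun j h3 (by omega)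
  obtain ⟨k, hk1, hk2, hk3⟩ := frankWolfe_gap_bound (η := η) (C := β * D ^ 2)
    -- The error is measured against the last iterate rather than a minimizer. Its final value is
    -- then `0`, no minimizer is needed, and the gap still dominates it because the last iterate is
    -- feasible.
    (e := fun k => icgModel g a β (p k) - icgModel g a β (p (4 * R + 1)))
    (h := fun k => icgGap g a β (p k) (q k)) hR (by positivity) hβη hη (by simp)
    (fun k h1 h2 α hα0 hα1 => by
      have hq := (hlmo k h1 h2).1
      have hs := icgModel_step_le hβ (p k) (q k) (hη.trans (hrun k h1 h2)).le hα0 hα1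
      rw [← hex.step k h1 fun j h3 h4 => hrun j h3 (by omega)] at hs
      have hd := hdiam _ hq _ (hmem k h1 (by omega))
      have : β / 2 * α ^ 2 * ‖q k - p k‖ ^ 2 ≤ β / 2 * α ^ 2 * D ^ 2 := by gcongr
      have h6 : β / 2 * α ^ 2 * D ^ 2 = β * D ^ 2 * α ^ 2 / 2 := by ring
      linarith)
    (fun k h1 h2 => (icgModel_sub_le_gap hβ.le _ _).trans
      ((hlmo k h1 h2).2 _ (hmem _ (by omega) le_rfl)))
  exact absurd hk3 (not_le.2 (hrun k hk1 hk2))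

theorem icgCalls_le (hK : Convex ℝ K) (hdiam : ∀ x ∈ K, ∀ y ∈ K, ‖x - y‖ ≤ D)
    (hex : IsICGExecution K g a β η p q) (ha : a ∈ K) (hβ : 0 < β) (hη : 0 < η) {R : ℕ}
    (hR : 1 ≤ R) (hβη : β * D ^ 2 ≤ η * R) : icgCalls g a β η p q ≤ 4 * R := by
  obtain ⟨k, hk1, hk2, hk3⟩ := hex.exists_gap_le hK hdiam ha hβ hη hR hβη
  exact (Nat.sInf_le (show k ∈ {k | 1 ≤ k ∧ icgGap g a β (p k) (q k) ≤ η} from ⟨hk1, hk3⟩)).trans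
    hk2

/-- The output of ICG is feasible and an `η`-approximate solution of the subproblem. -/
theorem output (hK : Convex ℝ K) (hex : IsICGExecution K g a β η p q) (ha : a ∈ K) (hβ : 0 ≤ β)
    (hη : 0 ≤ η) (hterm : ICGTerminates g a β η p q) :
    p (icgCalls g a β η p q) ∈ K ∧
      ∀ s ∈ K, icgGap g a β (p (icgCalls g a β η p q)) s ≤ η := by
  obtain ⟨h1, h2⟩ := Nat.sInf_mem (s := {k | 1 ≤ k ∧ icgGap g a β (p k) (q k) ≤ η}) hterm
  -- Minimality of the stopping index: no earlier test succeeded, so the oracle condition still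
  -- binds at that index, where the maximal gap is at most `η`.
  have hlt : ∀ j, 1 ≤ j → j < icgCalls g a β η p q → η < icgGap g a β (p j) (q j) := by
    intro j hj1 hj2
    by_contra hcon
    exact Nat.notMem_of_lt_sInf hj2 ⟨hj1, not_lt.1 hcon⟩
  exact ⟨hex.mem hK ha hβ hη h1 hlt, fun s hs => ((hex.lmo _ h1 hlt).2 s hs).trans h2⟩

end IsICGExecution

end InexactConditionalGradient

/-! ### The scalar recursion for the weighted potential -/

section Recursion

/-- Solution of the recursion for the weighted potential `k(k+1)(k+2) Δ k + c k * R k`,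
where `c k = 6 L k (k+1) / (k+2)`. -/
theorem weighted_recursion {Δ R : ℕ → ℝ} {L D N e lam κ : ℝ} {T : ℕ} (hL : 0 ≤ L) (hN : 0 ≤ N)
    (hR0 : ∀ k, k ≤ T → 0 ≤ R k) (hRD : ∀ k, k ≤ T → R k ≤ D ^ 2)
    (hbase : 1 ≤ T → 6 * Δ 1 + 4 * L * R 1 ≤ 4 * L * R 0 + 3 * N + e * (L * D ^ 2))
    (hstep : ∀ k : ℕ, 1 ≤ k → k + 1 ≤ T →
      ((k : ℝ) + 1) * (k + 2) * (k + 3) * Δ (k + 1)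
          + 6 * L * (k + 1) * (k + 2) / (k + 3) * R (k + 1)
        ≤ ((k : ℝ) * (k + 1) * (k + 2) + 2 * (k + 1)) * Δ k
          + 6 * L * (k + 1) * (k + 2) / (k + 3) * R k + e * (L * D ^ 2))
    (hκ : e + κ ≤ lam)
    (hlam : ∀ k : ℕ, 1 ≤ k → 2 * (lam * k - κ + 6 * k) ≤ (lam - e) * (k * (k + 2))) :
    ∀ k : ℕ, 1 ≤ k → k ≤ T →
      (k : ℝ) * (k + 1) * (k + 2) * Δ k + 6 * L * k * (k + 1) / (k + 2) * R k
        ≤ L * D ^ 2 * (lam * k - κ) + 3 * N * k + 6 * L * k * (k + 1) / (k + 2) * D ^ 2 := by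
  have hLD : 0 ≤ L * D ^ 2 := by positivity
  intro k hk
  induction k, hk using Nat.le_induction with
  | base =>
    intro hT
    have h1 := hbase hT
    have h2 : 4 * L * R 0 ≤ 4 * L * D ^ 2 :=
      mul_le_mul_of_nonneg_left (hRD 0 (by omega)) (by positivity)
    have h3 := mul_le_mul_of_nonneg_right hκ hLD
    norm_num
    nlinarith
  | succ k hk ih =>
    intro hkT
    have ih' := ih (by omega)
    have hs := hstep k hk hkT
    have hk1 : (1 : ℝ) ≤ k := by exact_mod_cast hk
    set V := (k : ℝ) * (k + 1) * (k + 2) * Δ k with hV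
    set c := 6 * L * k * (k + 1) / ((k : ℝ) + 2) with hc
    set c' := 6 * L * ((k : ℝ) + 1) * (k + 2) / ((k : ℝ) + 3) with hc'
    have hcnn : 0 ≤ c := by positivity
    -- The distance weights increase, so the distance terms do not telescope exactly; the defect
    -- `(c' - c) R k` is paid for with `R k ≤ D²`, which is why the invariant carries `c D²`.
    have hcc : c ≤ c' := by
      rw [hc, hc', div_le_div_iff₀ (by positivity) (by positivity)]
      have h : 6 * L * (k + 1) * (k + 2) * (k + 2) - 6 * L * k * (k + 1) * (k + 3)
        = 6 * L * (k + 1) * ((k : ℝ) + 4) := by ring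
      have h' : 0 ≤ 6 * L * (k + 1) * ((k : ℝ) + 4) := by positivity
      linarith
    have hck : c ≤ 6 * L * k := by
      rw [hc, div_le_iff₀ (by positivity)]
      have : 0 ≤ 6 * L * (k : ℝ) := by positivity
      nlinarith
    have h1 : ((k : ℝ) * (k + 1) * (k + 2) + 2 * (k + 1)) * Δ k = V + 2 / (k * (k + 2)) * V := by
      rw [hV]; field_simp
    have hVle : V ≤ L * D ^ 2 * (lam * k - κ + 6 * k) + 3 * N * k := by
      have h2 := mul_nonneg hcnn (hR0 k (by omega))
      have h3 := mul_le_mul_of_nonneg_right hck (sq_nonneg D)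
      nlinarith
    have hkk : (0 : ℝ) < k * (k + 2) := by positivity
    -- The multiplicative excess acts on a potential already known to be linear in `k`, so it is
    -- bounded by a constant. `hlam` is this requirement for the `L D²` part; for the `N` part,
    -- `6N/(k+2) ≤ 3N`.
    have h4 : 2 / (k * (k + 2)) * V ≤ (lam - e) * (L * D ^ 2) + 3 * N := by
      rw [div_mul_eq_mul_div, div_le_iff₀ hkk]
      have h5 := mul_le_mul_of_nonneg_right (hlam k hk) hLD
      have h6 : 0 ≤ N * k * (3 * (k : ℝ)) := by positivity
      nlinarith
    have h7 : c' * R k ≤ c * R k + (c' - c) * D ^ 2 := by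
      have := mul_le_mul_of_nonneg_left (hRD k (by omega)) (sub_nonneg.2 hcc)
      linarith
    rw [h1] at hs
    have e1 : ((k + 1 : ℕ) : ℝ) * ((k + 1 : ℕ) + 1) * ((k + 1 : ℕ) + 2) * Δ (k + 1)
        = ((k : ℝ) + 1) * (k + 2) * (k + 3) * Δ (k + 1) := by push_cast; ring
    have e2 : 6 * L * ((k + 1 : ℕ) : ℝ) * ((k + 1 : ℕ) + 1) / ((k + 1 : ℕ) + 2) = c' := by
      rw [hc']; push_cast; congr 1 <;> ring
    rw [e1, e2]
    push_cast
    linarith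

/-- The bound on the optimality gap that the recursion yields. -/
theorem gap_bound_of_weighted {L D N lam κ δ r : ℝ} {k : ℕ} (hk : 1 ≤ k) (hL : 0 ≤ L)
    (hκ : 0 ≤ κ) (hr : 0 ≤ r)
    (h : (k : ℝ) * (k + 1) * (k + 2) * δ + 6 * L * k * (k + 1) / (k + 2) * r
        ≤ L * D ^ 2 * (lam * k - κ) + 3 * N * k + 6 * L * k * (k + 1) / (k + 2) * D ^ 2) :
    δ ≤ 6 * L * D ^ 2 / ((k : ℝ) + 2) ^ 2
      + (lam * L * D ^ 2 + 3 * N) / (((k : ℝ) + 1) * (k + 2)) := by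
  have hk1 : (1 : ℝ) ≤ k := by exact_mod_cast hk
  have h1 : 0 ≤ 6 * L * k * (k + 1) / ((k : ℝ) + 2) * r := by positivity
  have h2 : 0 ≤ L * D ^ 2 * κ := by positivity
  have hA : (0 : ℝ) < k * (k + 1) * (k + 2) := by positivity
  refine le_of_mul_le_mul_left ?_ hA
  have h3 : (k : ℝ) * (k + 1) * (k + 2) * (6 * L * D ^ 2 / ((k : ℝ) + 2) ^ 2
      + (lam * L * D ^ 2 + 3 * N) / (((k : ℝ) + 1) * (k + 2)))
      = 6 * L * k * (k + 1) / (k + 2) * D ^ 2 + (lam * L * D ^ 2 + 3 * N) * k := by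
    field_simp
  rw [h3]
  linarith

end Recursion

/-! ### The deterministic one-step inequality -/

section OneStep

variable {E : Type*} [NormedAddCommGroup E] [InnerProductSpace ℝ E] [CompleteSpace E]

/-- One step of accelerated conditional gradient sliding with an inexact gradient `g`; `m` is a
proxy of the gradient at `z` up to the bias `B`. -/
theorem sliding_step {K : Set E} {f : E → ℝ} {L D B β γ η : ℝ} {xs x₀ y₀ x₁ y₁ z g m : E}
    (hK : Convex ℝ K) (hdiam : ∀ x ∈ K, ∀ y ∈ K, ‖x - y‖ ≤ D) (hf : ConvexOn ℝ K f)
    (hd : ∀ x ∈ K, DifferentiableAt ℝ f x)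
    (hlip : ∀ x ∈ K, ∀ y ∈ K, ‖gradient f x - gradient f y‖ ≤ L * ‖x - y‖)
    (hxs : xs ∈ K) (hx₀ : x₀ ∈ K) (hy₀ : y₀ ∈ K) (hy₁ : y₁ ∈ K)
    (hγ0 : 0 ≤ γ) (hγ1 : γ ≤ 1) (hβ : L * γ < β)
    (hz : z = (1 - γ) • x₀ + γ • y₀) (hx : x₁ = (1 - γ) • x₀ + γ • y₁)
    (hgap : ⟪g + β • (y₁ - y₀), y₁ - xs⟫ ≤ η) (hm : ‖m - gradient f z‖ ≤ B) :
    f x₁ - f xs ≤ (1 - γ) * (f x₀ - f xs) + γ * η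
      + γ * β / 2 * (‖y₀ - xs‖ ^ 2 - ‖y₁ - xs‖ ^ 2)
      + γ / (2 * (β - L * γ)) * ‖g - m‖ ^ 2 - γ * ⟪g - m, y₀ - xs⟫ + γ * (B * D) := by
  have hzK : z ∈ K := hz ▸ hK hx₀ hy₀ (sub_nonneg.2 hγ1) hγ0 (by ring)
  have hxK : x₁ ∈ K := hx ▸ hK hx₀ hy₁ (sub_nonneg.2 hγ1) hγ0 (by ring)
  set G := gradient f z with hG
  have h1 := descent_on_convex hK hd hlip hzK hxK
  have h2 := hf.inner_gradient_le hzK hx₀ (hd z hzK)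
  have h3 := hf.inner_gradient_le hzK hxs (hd z hzK)
  rw [← hG] at h1 h2 h3
  have e1 : x₁ - z = γ • (y₁ - y₀) := by rw [hx, hz]; module
  have e2 : ‖x₁ - z‖ ^ 2 = γ ^ 2 * ‖y₁ - y₀‖ ^ 2 := by
    rw [e1, norm_smul, mul_pow, Real.norm_eq_abs, sq_abs]
  -- The first two pieces are handled by convexity at `z`, the third by the stopping test of the
  -- inner loop.
  have e3 : x₁ - z = (1 - γ) • (x₀ - z) + γ • (xs - z) + γ • (y₁ - xs) := by rw [hx]; module
  have e4 : ⟪G, x₁ - z⟫ = (1 - γ) * ⟪G, x₀ - z⟫ + γ * ⟪G, xs - z⟫ + γ * ⟪G, y₁ - xs⟫ := by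
    rw [e3]; simp only [inner_add_right, inner_smul_right]
  have e5 : ⟪G, y₁ - xs⟫ = ⟪g + β • (y₁ - y₀), y₁ - xs⟫ - β * ⟪y₁ - y₀, y₁ - xs⟫
      - ⟪g - m, y₁ - y₀⟫ - ⟪g - m, y₀ - xs⟫ - ⟪m - G, y₁ - xs⟫ := by
    have : y₁ - xs = (y₁ - y₀) + (y₀ - xs) := by abel
    rw [this]
    simp only [inner_add_left, inner_add_right, inner_sub_left, inner_smul_left,
      RCLike.conj_to_real, inner_sub_right]
    ring
  have e6 : ⟪y₁ - y₀, y₁ - xs⟫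
      = (‖y₁ - y₀‖ ^ 2 + ‖y₁ - xs‖ ^ 2 - ‖y₀ - xs‖ ^ 2) / 2 := by
    have h := norm_sub_sq_real (y₁ - xs) (y₁ - y₀)
    rw [show y₁ - xs - (y₁ - y₀) = y₀ - xs by abel, real_inner_comm] at h
    linarith
  have b1 : -⟪m - G, y₁ - xs⟫ ≤ B * D := by
    have hi := abs_le.1 (abs_real_inner_le_norm (m - G) (y₁ - xs))
    have hD := hdiam _ hy₁ _ hxs
    have : ‖m - G‖ * ‖y₁ - xs‖ ≤ B * D :=
      mul_le_mul hm hD (norm_nonneg _) ((norm_nonneg _).trans hm)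
    linarith
  have hκ : 0 < β - L * γ := sub_pos.2 hβ
  -- Young's inequality. The prox term supplies `-β/2 ‖y₁ - y₀‖²`: the part `L γ / 2` absorbs the
  -- smoothness error and the surplus `(β - L γ)/2` absorbs the noise. The pairing with `y₀ - xs` is
  -- kept apart because its factor is fixed before sampling.
  have b2 : -⟪g - m, y₁ - y₀⟫ ≤ ‖g - m‖ ^ 2 / (2 * (β - L * γ))
      + (β - L * γ) / 2 * ‖y₁ - y₀‖ ^ 2 := by
    have hi := abs_le.1 (abs_real_inner_le_norm (g - m) (y₁ - y₀))
    have hq : ‖g - m‖ * ‖y₁ - y₀‖ ≤ ‖g - m‖ ^ 2 / (2 * (β - L * γ))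
        + (β - L * γ) / 2 * ‖y₁ - y₀‖ ^ 2 := by
      have hs : ‖g - m‖ ^ 2 / (2 * (β - L * γ)) + (β - L * γ) / 2 * ‖y₁ - y₀‖ ^ 2
          - ‖g - m‖ * ‖y₁ - y₀‖
          = (‖g - m‖ - (β - L * γ) * ‖y₁ - y₀‖) ^ 2 / (2 * (β - L * γ)) := by
        field_simp; ring
      have : 0 ≤ (‖g - m‖ - (β - L * γ) * ‖y₁ - y₀‖) ^ 2 / (2 * (β - L * γ)) := by positivity
      linarith
    linarith
  have hmain : ⟪G, y₁ - xs⟫ ≤ η + β / 2 * (‖y₀ - xs‖ ^ 2 - ‖y₁ - xs‖ ^ 2)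
      + ‖g - m‖ ^ 2 / (2 * (β - L * γ)) - L * γ / 2 * ‖y₁ - y₀‖ ^ 2
      - ⟪g - m, y₀ - xs⟫ + B * D := by
    rw [e5, e6]; linarith
  have hmul := mul_le_mul_of_nonneg_left hmain hγ0
  have h2' := mul_le_mul_of_nonneg_left h2 (sub_nonneg.2 hγ1)
  have h3' := mul_le_mul_of_nonneg_left h3 hγ0
  rw [e2, e4] at h1
  have e7 : γ / (2 * (β - L * γ)) * ‖g - m‖ ^ 2 = γ * (‖g - m‖ ^ 2 / (2 * (β - L * γ))) := by ring
  rw [e7]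
  linarith

variable {K : Set E} {f : E → ℝ} {L D : ℝ} {xs : E}

/-- Smoothness bound on the optimality gap over a set of bounded diameter. -/
theorem gap_le_of_smooth (hK : Convex ℝ K) (hdiam : ∀ x ∈ K, ∀ y ∈ K, ‖x - y‖ ≤ D) (hL : 0 ≤ L)
    (hd : ∀ x ∈ K, DifferentiableAt ℝ f x)
    (hlip : ∀ x ∈ K, ∀ y ∈ K, ‖gradient f x - gradient f y‖ ≤ L * ‖x - y‖)
    (hxs : xs ∈ K) {y : E} (hy : y ∈ K) :
    f y - f xs ≤ ⟪gradient f xs, y - xs⟫ + L * D ^ 2 / 2 := by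
  have h := descent_on_convex hK hd hlip hxs hy
  have h2 : L / 2 * ‖y - xs‖ ^ 2 ≤ L / 2 * D ^ 2 := by
    have := hdiam _ hy _ hxs
    gcongr
  linarith

theorem gap_le_norm_gradient (hK : Convex ℝ K) (hdiam : ∀ x ∈ K, ∀ y ∈ K, ‖x - y‖ ≤ D)
    (hL : 0 ≤ L) (hd : ∀ x ∈ K, DifferentiableAt ℝ f x)
    (hlip : ∀ x ∈ K, ∀ y ∈ K, ‖gradient f x - gradient f y‖ ≤ L * ‖x - y‖)
    (hxs : xs ∈ K) {y : E} (hy : y ∈ K) :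
    f y - f xs ≤ ‖gradient f xs‖ * D + L * D ^ 2 / 2 := by
  have h := gap_le_of_smooth hK hdiam hL hd hlip hxs hy
  have h1 := real_inner_le_norm (gradient f xs) (y - xs)
  have h2 := mul_le_mul_of_nonneg_left (hdiam _ hy _ hxs) (norm_nonneg (gradient f xs))
  linarith

/-- If `x = (1 - γ) w + γ y`, then the linearized gap at `y` is controlled by the gap at `x`. -/
theorem inner_gradient_le_gap (hK : Convex ℝ K) (hf : ConvexOn ℝ K f)
    (hd : DifferentiableAt ℝ f xs) (hxs : xs ∈ K) (hmin : ∀ w ∈ K, f xs ≤ f w) {w y : E}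
    (hw : w ∈ K) (hy : y ∈ K) {γ : ℝ} (hγ0 : 0 ≤ γ) (hγ1 : γ ≤ 1) :
    γ * ⟪gradient f xs, y - xs⟫ ≤ f ((1 - γ) • w + γ • y) - f xs := by
  have hx : (1 - γ) • w + γ • y ∈ K := hK hw hy (sub_nonneg.2 hγ1) hγ0 (by ring)
  have h1 := hf.inner_gradient_le hxs hx hd
  have e : (1 - γ) • w + γ • y - xs = (1 - γ) • (w - xs) + γ • (y - xs) := by module
  rw [e, inner_add_right, inner_smul_right, inner_smul_right] at h1
  have h2 := mul_nonneg (sub_nonneg.2 hγ1)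
    (inner_gradient_nonneg_of_isMinOn hK hd hxs hw hmin)
  linarith

end OneStep

/-! ### Mean and variance of a batch drawn independently of the past -/

section Batch

variable {E : Type*} [NormedAddCommGroup E] [InnerProductSpace ℝ E]

theorem integrable_inner_of_sq {α : Type*} [MeasurableSpace α] {μ : Measure α} {X Y : α → E}
    (hX : AEStronglyMeasurable X μ) (hY : AEStronglyMeasurable Y μ)
    (hX2 : Integrable (fun a => ‖X a‖ ^ 2) μ) (hY2 : Integrable (fun a => ‖Y a‖ ^ 2) μ) :
    Integrable (fun a => ⟪X a, Y a⟫) μ := by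
  refine (hX2.add hY2).mono' (hX.inner hY) (Filter.Eventually.of_forall fun a => ?_)
  have h := norm_inner_le_norm (𝕜 := ℝ) (X a) (Y a)
  simp only [Pi.add_apply]
  nlinarith [sq_nonneg (‖X a‖ - ‖Y a‖), sq_nonneg (‖X a‖), sq_nonneg (‖Y a‖)]

variable [FiniteDimensional ℝ E] [MeasurableSpace E] [BorelSpace E] {S : Type*} [MeasurableSpace S]

/-- The sum of `n` independent centered copies of a square-integrable random vector: mean, square
integrability, second moment. -/
theorem sum_pi_centered {n : ℕ} {smp : Measure S} [IsProbabilityMeasure smp] {H : S → E}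
    (hH : Integrable H smp) (hmean : ∫ s, H s ∂smp = 0)
    (hH2 : Integrable (fun s => ‖H s‖ ^ 2) smp) :
    Integrable (fun σ : Fin n → S => ∑ i, H (σ i)) (Measure.pi fun _ => smp) ∧
    ∫ σ : Fin n → S, ∑ i, H (σ i) ∂(Measure.pi fun _ => smp) = 0 ∧
    Integrable (fun σ : Fin n → S => ‖∑ i, H (σ i)‖ ^ 2) (Measure.pi fun _ => smp) ∧
    ∫ σ : Fin n → S, ‖∑ i, H (σ i)‖ ^ 2 ∂(Measure.pi fun _ => smp)
      = n * ∫ s, ‖H s‖ ^ 2 ∂smp := by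
  set π : Measure (Fin n → S) := Measure.pi fun _ => smp with hπ
  have mp : ∀ i : Fin n, MeasurePreserving (Function.eval i) π smp := fun i =>
    measurePreserving_eval (fun _ => smp) i
  have hi : ∀ i : Fin n, Integrable (fun σ : Fin n → S => H (σ i)) π := fun i =>
    (mp i).integrable_comp_of_integrable hH
  have hi2 : ∀ i : Fin n, Integrable (fun σ : Fin n → S => ‖H (σ i)‖ ^ 2) π := fun i =>
    (mp i).integrable_comp_of_integrable hH2
  have hm : ∀ i : Fin n, ∫ σ, H (σ i) ∂π = 0 := fun i => by
    have := integral_map (μ := π) (φ := Function.eval i) (mp i).measurable.aemeasurable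
      (f := H) (by rw [(mp i).map_eq]; exact hH.aestronglyMeasurable)
    rw [(mp i).map_eq, hmean] at this
    exact this.symm
  have hm2 : ∀ i : Fin n, ∫ σ, ‖H (σ i)‖ ^ 2 ∂π = ∫ s, ‖H s‖ ^ 2 ∂smp := fun i => by
    have := integral_map (μ := π) (φ := Function.eval i) (mp i).measurable.aemeasurable
      (f := fun s => ‖H s‖ ^ 2) (by rw [(mp i).map_eq]; exact hH2.aestronglyMeasurable)
    rw [(mp i).map_eq] at this
    exact this.symm
  have hin : ∀ i j : Fin n, Integrable (fun σ : Fin n → S => ⟪H (σ i), H (σ j)⟫) π := fun i j =>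
    integrable_inner_of_sq (hi i).aestronglyMeasurable (hi j).aestronglyMeasurable (hi2 i) (hi2 j)
  have hcross : ∀ i j : Fin n, i ≠ j → ∫ σ, ⟪H (σ i), H (σ j)⟫ ∂π = 0 := fun i j hij => by
    have hind : iIndepFun (fun (i : Fin n) (σ : Fin n → S) => H (σ i)) π :=
      iIndepFun_pi fun _ => hH.aestronglyMeasurable.aemeasurable
    have := (hind.indepFun hij).integral_bilin (hi i) (hi j) (innerSL ℝ)
    exact this.trans (by simp [hm])
  have hsq : ∀ σ : Fin n → S, ‖∑ i, H (σ i)‖ ^ 2 = ∑ i, ∑ j, ⟪H (σ i), H (σ j)⟫ := fun σ => by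
    rw [← real_inner_self_eq_norm_sq, sum_inner]
    simp_rw [inner_sum]
  refine ⟨integrable_finsetSum _ fun i _ => hi i, ?_, ?_, ?_⟩
  · rw [integral_finsetSum _ fun i _ => hi i]
    simp [hm]
  · simp_rw [hsq]
    exact integrable_finsetSum _ fun i _ => integrable_finsetSum _ fun j _ => hin i j
  · simp_rw [hsq]
    rw [integral_finsetSum _ fun i _ => integrable_finsetSum _ fun j _ => hin i j]
    have : ∀ i : Fin n, ∫ σ : Fin n → S, ∑ j, ⟪H (σ i), H (σ j)⟫ ∂π = ∫ s, ‖H s‖ ^ 2 ∂smp := by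
      intro i
      rw [integral_finsetSum _ fun j _ => hin i j, Finset.sum_eq_single i
        (fun j _ hj => hcross i j hj.symm) (by simp), ← hm2 i]
      simp_rw [real_inner_self_eq_norm_sq]
    simp [this]

/-- The error of the average of `n` samples. -/
def batchError (G : E → S → E) (smp : Measure S) {n : ℕ} (x : E) (σ : Fin n → S) : E :=
  (n : ℝ)⁻¹ • ∑ i, G x (σ i) - ∫ s, G x s ∂smp

theorem measurable_batchError {G : E → S → E} (hG : Measurable (fun p : E × S => G p.1 p.2))
    (smp : Measure S) [SFinite smp] (n : ℕ) :
    Measurable (fun p : E × (Fin n → S) => batchError G smp p.1 p.2) := by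
  have hm : Measurable (fun x : E => ∫ s, G x s ∂smp) :=
    (StronglyMeasurable.integral_prod_right' (ν := smp) hG.stronglyMeasurable).measurable
  refine Measurable.sub (Measurable.const_smul (Finset.measurable_sum _ fun i _ => ?_) _)
    (hm.comp measurable_fst)
  exact hG.comp (measurable_fst.prodMk ((measurable_pi_apply i).comp measurable_snd))

theorem batchError_moments {G : E → S → E} {smp : Measure S} [IsProbabilityMeasure smp] {n : ℕ}
    (hn : 1 ≤ n) {x : E} (hint : Integrable (G x) smp)
    (hint2 : Integrable (fun s => ‖G x s - ∫ s, G x s ∂smp‖ ^ 2) smp) :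
    Integrable (fun σ : Fin n → S => batchError G smp x σ) (Measure.pi fun _ => smp) ∧
    ∫ σ : Fin n → S, batchError G smp x σ ∂(Measure.pi fun _ => smp) = 0 ∧
    Integrable (fun σ : Fin n → S => ‖batchError G smp x σ‖ ^ 2) (Measure.pi fun _ => smp) ∧
    ∫ σ : Fin n → S, ‖batchError G smp x σ‖ ^ 2 ∂(Measure.pi fun _ => smp)
      = (n : ℝ)⁻¹ * ∫ s, ‖G x s - ∫ s, G x s ∂smp‖ ^ 2 ∂smp := by
  have hn0 : (n : ℝ) ≠ 0 := by positivity
  have heq : ∀ σ : Fin n → S, batchError G smp x σ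
      = (n : ℝ)⁻¹ • ∑ i, (G x (σ i) - ∫ s, G x s ∂smp) := fun σ => by
    rw [batchError, Finset.sum_sub_distrib, smul_sub]
    simp only [Finset.sum_const, Finset.card_univ, Fintype.card_fin]
    rw [← Nat.cast_smul_eq_nsmul ℝ, smul_smul, inv_mul_cancel₀ hn0, one_smul]
  obtain ⟨h1, h2, h3, h4⟩ := sum_pi_centered (n := n) (hint.sub (integrable_const _))
    (by simp [integral_sub hint (integrable_const _)]) hint2
  simp only [Pi.sub_apply] at h1 h2 h3 h4
  simp_rw [heq, norm_smul, mul_pow]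
  refine ⟨h1.smul _, ?_, h3.const_mul _, ?_⟩
  · rw [integral_smul, h2, smul_zero]
  · rw [integral_const_mul, h4, Real.norm_eq_abs, sq_abs]
    field_simp

/-- Independence makes the joint law of `(z, w)` and the batch a product measure. By Fubini, `z` and
`w` can be frozen and the moments of a batch at a fixed point used: the variance gains the factor
`1/n` and the pairing with `w` averages to zero. This replaces conditional expectations. -/
theorem batch_estimate {Ω : Type*} {m' mΩ : MeasurableSpace Ω} {P : Measure Ω}
    [IsProbabilityMeasure P] (hm' : m' ≤ mΩ) {K : Set E} (hK : MeasurableSet K) {G : E → S → E}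
    (hG : Measurable (fun p : E × S => G p.1 p.2)) {smp : Measure S} [IsProbabilityMeasure smp]
    {n : ℕ} (hn : 1 ≤ n) {s : Fin n → Ω → S} (hs : ∀ i, Measurable (s i))
    (hdist : ∀ i, P.map (s i) = smp) (hiid : iIndepFun s P)
    (hpast : Indep m' (MeasurableSpace.comap (fun ω i => s i ω) MeasurableSpace.pi) P)
    {z w : Ω → E} (hz : Measurable[m'] z) (hw : Measurable[m'] w) (hzK : ∀ ω, z ω ∈ K) {c : ℝ}
    (hwc : ∀ ω, ‖w ω‖ ≤ c) (hint : ∀ x ∈ K, Integrable (G x) smp) {V : E → ℝ}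
    (hvar : ∀ x ∈ K, Integrable (fun s => ‖G x s - ∫ s, G x s ∂smp‖ ^ 2) smp ∧
      ∫ s, ‖G x s - ∫ s, G x s ∂smp‖ ^ 2 ∂smp ≤ V x)
    (hV : Integrable (fun ω => V (z ω)) P) :
    Integrable (fun ω => ‖batchError G smp (z ω) (fun i => s i ω)‖ ^ 2) P ∧
    ∫ ω, ‖batchError G smp (z ω) (fun i => s i ω)‖ ^ 2 ∂P ≤ (n : ℝ)⁻¹ * ∫ ω, V (z ω) ∂P ∧
    Integrable (fun ω => ⟪batchError G smp (z ω) (fun i => s i ω), w ω⟫) P ∧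
    ∫ ω, ⟪batchError G smp (z ω) (fun i => s i ω), w ω⟫ ∂P = 0 := by
  have hz' : Measurable z := hz.mono hm' le_rfl
  have hw' : Measurable w := hw.mono hm' le_rfl
  have hsm : Measurable (fun ω i => s i ω) := measurable_pi_lambda _ hs
  set π : Measure (Fin n → S) := Measure.pi fun _ => smp with hπ
  set Q : Measure (E × E) := P.map (fun ω => (z ω, w ω)) with hQ
  have hzw : Measurable (fun ω => (z ω, w ω)) := hz'.prodMk hw'
  have : IsProbabilityMeasure Q := Measure.isProbabilityMeasure_map hzw.aemeasurable
  have hmapπ : P.map (fun ω i => s i ω) = π := by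
    rw [(iIndepFun_iff_map_fun_eq_pi_map fun i => (hs i).aemeasurable).1 hiid]
    simp_rw [hdist, hπ]
  have hindep : IndepFun (fun ω => (z ω, w ω)) (fun ω i => s i ω) P := by
    rw [IndepFun_iff_Indep]
    refine indep_of_indep_of_le_left hpast ?_
    exact (hz.prodMk hw).comap_le
  have hlaw : P.map (fun ω => ((z ω, w ω), fun i => s i ω)) = Q.prod π := by
    rw [(indepFun_iff_map_prod_eq_prod_map_map hzw.aemeasurable hsm.aemeasurable).1 hindep, hmapπ]
  have hall : Measurable (fun ω => ((z ω, w ω), fun i => s i ω)) := hzw.prodMk hsm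
  have hbe := measurable_batchError hG smp n
  have hbe' : Measurable (fun r : (E × E) × (Fin n → S) => batchError G smp r.1.1 r.2) :=
    hbe.comp ((measurable_fst.comp measurable_fst).prodMk measurable_snd)
  have hQK : ∀ᵐ r ∂Q, r.1 ∈ K := by
    rw [hQ, ae_map_iff hzw.aemeasurable (measurable_fst hK)]
    exact Filter.Eventually.of_forall hzK
  have hQc : ∀ᵐ r ∂Q, ‖r.2‖ ≤ c := by
    rw [hQ, ae_map_iff hzw.aemeasurable
      (measurableSet_le (f := fun r : E × E => ‖r.2‖) (by fun_prop) measurable_const)]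
    exact Filter.Eventually.of_forall hwc
  -- square integrability
  have hsq_meas : Measurable (fun r : (E × E) × (Fin n → S) => ‖batchError G smp r.1.1 r.2‖ ^ 2) :=
    hbe'.norm.pow_const 2
  have hinner_meas : Measurable
      (fun r : E × E => ∫ σ, ‖batchError G smp r.1 σ‖ ^ 2 ∂π) :=
    (StronglyMeasurable.integral_prod_right' (ν := π) hsq_meas.stronglyMeasurable).measurable
  have hbound : ∀ ω, ∫ σ, ‖batchError G smp (z ω) σ‖ ^ 2 ∂π ≤ (n : ℝ)⁻¹ * V (z ω) := fun ω => by
    rw [(batchError_moments hn (hint _ (hzK ω)) (hvar _ (hzK ω)).1).2.2.2]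
    exact mul_le_mul_of_nonneg_left (hvar _ (hzK ω)).2 (by positivity)
  have hinnerP : Integrable (fun ω => ∫ σ, ‖batchError G smp (z ω) σ‖ ^ 2 ∂π) P := by
    refine (hV.const_mul (n : ℝ)⁻¹).mono' (hinner_meas.comp hzw).aestronglyMeasurable
      (Filter.Eventually.of_forall fun ω => ?_)
    rw [Real.norm_of_nonneg (integral_nonneg fun σ => by positivity)]
    exact hbound ω
  have hinnerQ : Integrable (fun r : E × E => ∫ σ, ‖batchError G smp r.1 σ‖ ^ 2 ∂π) Q :=
    (integrable_map_measure hinner_meas.aestronglyMeasurable hzw.aemeasurable).2 hinnerP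
  have hsqI : Integrable (fun r : (E × E) × (Fin n → S) => ‖batchError G smp r.1.1 r.2‖ ^ 2)
      (Q.prod π) := by
    refine (integrable_prod_iff hsq_meas.aestronglyMeasurable).2 ⟨?_, ?_⟩
    · filter_upwards [hQK] with r hr
      exact (batchError_moments hn (hint _ hr) (hvar _ hr).1).2.2.1
    · simpa only [norm_pow, norm_norm] using hinnerQ
  have hsqP := (integrable_map_measure (f := fun ω => ((z ω, w ω), fun i => s i ω))
    hsq_meas.aestronglyMeasurable hall.aemeasurable).1 (hlaw ▸ hsqI)
  have hsqv : ∫ ω, ‖batchError G smp (z ω) (fun i => s i ω)‖ ^ 2 ∂P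
      = ∫ ω, ∫ σ, ‖batchError G smp (z ω) σ‖ ^ 2 ∂π ∂P := by
    have h1 := integral_map (μ := P) (f := fun r : (E × E) × (Fin n → S) => ‖batchError G smp r.1.1 r.2‖ ^ 2)
      hall.aemeasurable hsq_meas.aestronglyMeasurable
    rw [hlaw, integral_prod _ hsqI, integral_map hzw.aemeasurable
      hinner_meas.aestronglyMeasurable] at h1
    exact h1.symm
  -- the cross term
  have hin_meas : Measurable
      (fun r : (E × E) × (Fin n → S) => ⟪batchError G smp r.1.1 r.2, r.1.2⟫) :=
    hbe'.inner (measurable_snd.comp measurable_fst)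
  have hwI : Integrable (fun r : (E × E) × (Fin n → S) => ‖r.1.2‖ ^ 2) (Q.prod π) := by
    refine Integrable.comp_fst (f := fun r : E × E => ‖r.2‖ ^ 2) ?_ π
    refine (integrable_const (c ^ 2)).mono' (by fun_prop) ?_
    filter_upwards [hQc] with r hr
    rw [norm_pow, norm_norm]
    gcongr
  have hinI : Integrable (fun r : (E × E) × (Fin n → S) => ⟪batchError G smp r.1.1 r.2, r.1.2⟫)
      (Q.prod π) :=
    integrable_inner_of_sq hbe'.aestronglyMeasurable
      (measurable_snd.comp measurable_fst).aestronglyMeasurable hsqI hwI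
  have hinP := (integrable_map_measure (f := fun ω => ((z ω, w ω), fun i => s i ω))
    hin_meas.aestronglyMeasurable hall.aemeasurable).1 (hlaw ▸ hinI)
  refine ⟨hsqP, ?_, hinP, ?_⟩
  · rw [hsqv, ← integral_const_mul]
    exact integral_mono hinnerP (hV.const_mul _) hbound
  · have h1 := integral_map (μ := P)
      (f := fun r : (E × E) × (Fin n → S) => ⟪batchError G smp r.1.1 r.2, r.1.2⟫)
      hall.aemeasurable hin_meas.aestronglyMeasurable
    rw [hlaw, integral_prod _ hinI] at h1
    refine h1.symm.trans ?_
    refine integral_eq_zero_of_ae ?_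
    filter_upwards [hQK] with r hr
    obtain ⟨hI, h0, -, -⟩ := batchError_moments hn (hint _ hr) (hvar _ hr).1
    have h2 := integral_inner (𝕜 := ℝ) hI r.2
    rw [h0, inner_zero_right] at h2
    simpa only [real_inner_comm, Pi.zero_apply] using h2

end Batch

/-! ### Arithmetic of the parameter choices -/

section Parameters

variable {L D : ℝ} {t : ℕ}

theorem scgsBeta_pos (hL : 0 < L) : 0 < scgsBeta L t := by
  unfold scgsBeta; positivity

theorem scgsEta_pos (hL : 0 < L) (hD : 0 < D) (ht : 1 ≤ t) : 0 < scgsEta L D t := by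
  have : (1 : ℝ) ≤ t := by exact_mod_cast ht
  unfold scgsEta; positivity

theorem scgsGamma_nonneg : 0 ≤ scgsGamma t := by
  unfold scgsGamma; positivity

theorem scgsGamma_le_one (ht : 1 ≤ t) : scgsGamma t ≤ 1 := by
  have : (1 : ℝ) ≤ t := by exact_mod_cast ht
  rw [scgsGamma, div_le_one (by positivity)]
  linarith

/-- The curvature-to-tolerance ratio is `4t(t+1)/(t+2)`. Taking `R = 4t` in the inner analysis gives
at most `16t` oracle calls in iteration `t`. -/
theorem scgsBeta_mul_sq_le (hL : 0 < L) (ht : 1 ≤ t) :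
    scgsBeta L t * D ^ 2 ≤ scgsEta L D t * ((4 * t : ℕ) : ℝ) := by
  have h1 : (1 : ℝ) ≤ t := by exact_mod_cast ht
  have e : scgsEta L D t * ((4 * t : ℕ) : ℝ) = 4 * L * D ^ 2 / (t + 1) := by
    rw [scgsEta]; push_cast; field_simp
  rw [e, scgsBeta, div_mul_eq_mul_div]
  gcongr
  linarith

theorem scgsBeta_sub (t : ℕ) : scgsBeta L t - L * scgsGamma t = L / (t + 2) := by
  rw [scgsBeta, scgsGamma]; ring

end Parameters

theorem integral_mono_linear {Ω : Type*} {mΩ : MeasurableSpace Ω} {P : Measure Ω}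
    [IsProbabilityMeasure P] {X₁ Y₁ X₀ Y₀ Z W : Ω → ℝ} {a₁ a₀ c k l r : ℝ}
    (hX₁ : Integrable X₁ P) (hY₁ : Integrable Y₁ P) (hX₀ : Integrable X₀ P)
    (hY₀ : Integrable Y₀ P) (hZ : Integrable Z P) (hW : Integrable W P)
    (h : ∀ ω, a₁ * X₁ ω + c * Y₁ ω ≤ a₀ * X₀ ω + c * Y₀ ω + k * Z ω - l * W ω + r) :
    a₁ * ∫ ω, X₁ ω ∂P + c * ∫ ω, Y₁ ω ∂P
      ≤ a₀ * ∫ ω, X₀ ω ∂P + c * ∫ ω, Y₀ ω ∂P + k * ∫ ω, Z ω ∂P - l * ∫ ω, W ω ∂P + r := by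
  have h1 : Integrable (fun ω => a₁ * X₁ ω + c * Y₁ ω) P := (hX₁.const_mul _).add (hY₁.const_mul _)
  have h2 : Integrable (fun ω => a₀ * X₀ ω + c * Y₀ ω) P := (hX₀.const_mul _).add (hY₀.const_mul _)
  have h3 : Integrable (fun ω => a₀ * X₀ ω + c * Y₀ ω + k * Z ω) P := h2.add (hZ.const_mul _)
  have h4 : Integrable (fun ω => a₀ * X₀ ω + c * Y₀ ω + k * Z ω - l * W ω) P :=
    h3.sub (hW.const_mul _)
  have h5 := integral_mono h1 (h4.add (integrable_const r)) h
  simp only [Pi.add_apply] at h5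
  rw [integral_add (hX₁.const_mul _) (hY₁.const_mul _), integral_add h4 (integrable_const r),
    integral_sub h3 (hW.const_mul _), integral_add h2 (hZ.const_mul _),
    integral_add (hX₀.const_mul _) (hY₀.const_mul _)] at h5
  simpa only [integral_const_mul, integral_const, probReal_univ, one_smul] using h5

/-! ### Pathwise feasibility, termination, oracle count and measurability -/

namespace IsSCGSRun

variable {d : ℕ} {S : Type u} [MeasurableSpace S] {Ω : Type v} {mΩ : MeasurableSpace Ω}
  {K : Set (EuclideanSpace ℝ (Fin d))}
  {G : EuclideanSpace ℝ (Fin d) → S → EuclideanSpace ℝ (Fin d)} {smp : Measure S}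
  {L D : ℝ} {b : ℕ → ℕ} {T : ℕ} {P : Measure Ω} {ℱ : Filtration ℕ mΩ}
  {s : (t : ℕ) → Fin (b t) → Ω → S} {x y z g : ℕ → Ω → EuclideanSpace ℝ (Fin d)}
  {p q : ℕ → ℕ → Ω → EuclideanSpace ℝ (Fin d)}

theorem mem (hL : 0 < L) (hD : 0 < D) (hK : Convex ℝ K)
    (hdiam : ∀ x ∈ K, ∀ y ∈ K, ‖x - y‖ ≤ D)
    (hrun : IsSCGSRun K G smp (scgsBeta L) scgsGamma (scgsEta L D) b T P ℱ s x y z g p q)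
    (ω : Ω) : ∀ t, t ≤ T → x t ω ∈ K ∧ y t ω ∈ K := by
  intro t
  induction t with
  | zero =>
    intro _
    obtain ⟨x0, h0, h1⟩ := hrun.init_x
    rw [hrun.init_y, h1]
    exact ⟨h0, h0⟩
  | succ t ih =>
    intro ht
    obtain ⟨hx, hy⟩ := ih (by omega)
    have h1 : 1 ≤ t + 1 := by omega
    have hex := hrun.icg (t + 1) h1 ht ω
    rw [Nat.add_sub_cancel] at hex
    obtain ⟨k, hk1, -, hk⟩ := hex.exists_gap_le hK hdiam hy (scgsBeta_pos hL)
      (scgsEta_pos hL hD h1) (by omega) (scgsBeta_mul_sq_le hL h1)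
    have hy1 : y (t + 1) ω ∈ K := by
      rw [hrun.y_eq (t + 1) h1 ht ω, Nat.add_sub_cancel]
      exact (hex.output hK hy (scgsBeta_pos hL).le (scgsEta_pos hL hD h1).le ⟨k, hk1, hk⟩).1
    refine ⟨?_, hy1⟩
    rw [hrun.x_eq (t + 1) h1 ht ω, Nat.add_sub_cancel]
    exact hK hx hy1 (sub_nonneg.2 (scgsGamma_le_one h1)) scgsGamma_nonneg (by ring)

theorem terminates (hL : 0 < L) (hD : 0 < D) (hK : Convex ℝ K)
    (hdiam : ∀ x ∈ K, ∀ y ∈ K, ‖x - y‖ ≤ D)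
    (hrun : IsSCGSRun K G smp (scgsBeta L) scgsGamma (scgsEta L D) b T P ℱ s x y z g p q)
    (ω : Ω) : InnerLoopsTerminate (scgsBeta L) (scgsEta L D) T y g p q ω := by
  intro t h1 ht
  obtain ⟨k, hk1, -, hk⟩ := (hrun.icg t h1 ht ω).exists_gap_le hK hdiam
    (hrun.mem hL hD hK hdiam ω (t - 1) (by omega)).2 (scgsBeta_pos hL)
    (scgsEta_pos hL hD h1) (by omega) (scgsBeta_mul_sq_le hL h1)
  exact ⟨k, hk1, hk⟩

theorem lmoCalls_le (hL : 0 < L) (hD : 0 < D) (hK : Convex ℝ K)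
    (hdiam : ∀ x ∈ K, ∀ y ∈ K, ‖x - y‖ ≤ D)
    (hrun : IsSCGSRun K G smp (scgsBeta L) scgsGamma (scgsEta L D) b T P ℱ s x y z g p q)
    (ω : Ω) : lmoCalls (scgsBeta L) (scgsEta L D) T y g p q ω ≤ 16 * T ^ 2 := by
  have h : ∀ t ∈ Finset.Icc 1 T, icgCalls (g t ω) (y (t - 1) ω) (scgsBeta L t) (scgsEta L D t)
      (fun k => p t k ω) (fun k => q t k ω) ≤ 16 * T := by
    intro t ht
    obtain ⟨h1, ht⟩ := Finset.mem_Icc.1 ht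
    have := (hrun.icg t h1 ht ω).icgCalls_le hK hdiam
      (hrun.mem hL hD hK hdiam ω (t - 1) (by omega)).2 (scgsBeta_pos hL)
      (scgsEta_pos hL hD h1) (by omega) (scgsBeta_mul_sq_le hL h1)
    omega
  refine (Finset.sum_le_card_nsmul _ _ _ h).trans (le_of_eq ?_)
  simp only [Nat.card_Icc, Nat.add_sub_cancel, smul_eq_mul]
  ring

theorem gap_le (hL : 0 < L) (hD : 0 < D) (hK : Convex ℝ K)
    (hdiam : ∀ x ∈ K, ∀ y ∈ K, ‖x - y‖ ≤ D)
    (hrun : IsSCGSRun K G smp (scgsBeta L) scgsGamma (scgsEta L D) b T P ℱ s x y z g p q)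
    {t : ℕ} (h1 : 1 ≤ t) (ht : t ≤ T) (ω : Ω) {w : EuclideanSpace ℝ (Fin d)} (hw : w ∈ K) :
    ⟪g t ω + scgsBeta L t • (y t ω - y (t - 1) ω), y t ω - w⟫ ≤ scgsEta L D t := by
  have h := ((hrun.icg t h1 ht ω).output hK (hrun.mem hL hD hK hdiam ω (t - 1) (by omega)).2
    (scgsBeta_pos hL).le (scgsEta_pos hL hD h1).le
    (hrun.terminates hL hD hK hdiam ω t h1 ht)).2 w hw
  rw [← hrun.y_eq t h1 ht ω] at h
  exact h

theorem measurable_x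
    (hrun : IsSCGSRun K G smp (scgsBeta L) scgsGamma (scgsEta L D) b T P ℱ s x y z g p q) :
    ∀ t, t ≤ T → Measurable[ℱ t] (x t) := by
  intro t
  induction t with
  | zero =>
    intro _
    obtain ⟨x0, -, h1⟩ := hrun.init_x
    rw [funext h1]
    exact measurable_const
  | succ t ih =>
    intro ht
    have hx := (ih (by omega)).mono (ℱ.mono (Nat.le_succ t)) le_rfl
    have hy := hrun.adapted (t + 1) ht
    rw [funext (hrun.x_eq (t + 1) (by omega) ht)]
    exact (hx.const_smul (1 - scgsGamma (t + 1))).add (hy.const_smul (scgsGamma (t + 1)))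

theorem measurable_z
    (hrun : IsSCGSRun K G smp (scgsBeta L) scgsGamma (scgsEta L D) b T P ℱ s x y z g p q)
    {t : ℕ} (h1 : 1 ≤ t) (ht : t ≤ T) : Measurable[ℱ (t - 1)] (z t) := by
  rw [funext (hrun.z_eq t h1 ht)]
  exact ((hrun.measurable_x (t - 1) (by omega)).const_smul (1 - scgsGamma t)).add
    ((hrun.adapted (t - 1) (by omega)).const_smul (scgsGamma t))

theorem z_mem (hL : 0 < L) (hD : 0 < D) (hK : Convex ℝ K)
    (hdiam : ∀ x ∈ K, ∀ y ∈ K, ‖x - y‖ ≤ D)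
    (hrun : IsSCGSRun K G smp (scgsBeta L) scgsGamma (scgsEta L D) b T P ℱ s x y z g p q)
    {t : ℕ} (h1 : 1 ≤ t) (ht : t ≤ T) (ω : Ω) : z t ω ∈ K := by
  obtain ⟨hx, hy⟩ := hrun.mem hL hD hK hdiam ω (t - 1) (by omega)
  rw [hrun.z_eq t h1 ht ω]
  exact hK hx hy (sub_nonneg.2 (scgsGamma_le_one h1)) scgsGamma_nonneg (by ring)

/-! ### The expected one-step inequality and the convergence rate -/

section Rate

variable {Ξ : Type*} [MeasurableSpace Ξ] {F : EuclideanSpace ℝ (Fin d) → Ξ → ℝ} {μ : Measure Ξ}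
  {xs : EuclideanSpace ℝ (Fin d)}

/-- Gap at the extrapolated point in terms of the gap at the previous iterate. -/
theorem gap_z_le (hL : 0 < L) (hD : 0 < D) (hprob : ConvexSmoothProblem K F μ L D)
    (hsol : IsSolution K F μ xs)
    (hrun : IsSCGSRun K G smp (scgsBeta L) scgsGamma (scgsEta L D) b T P ℱ s x y z g p q)
    {t : ℕ} (h1 : 1 ≤ t) (ht : t + 1 ≤ T) (ω : Ω) :
    objective F μ (z (t + 1) ω) - objective F μ xs
      ≤ 2 * (t + 1) / (t + 3) * (objective F μ (x t ω) - objective F μ xs)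
        + 3 / (t + 3) * (L * D ^ 2 / 2) := by
  have hm := fun r hr => hrun.mem hL hD hprob.convex hprob.diam_le ω r hr
  obtain ⟨hx, hy⟩ := hm t (by omega)
  set f := objective F μ with hf
  have hγ : scgsGamma (t + 1) = 3 / ((t : ℝ) + 3) := by rw [scgsGamma]; push_cast; ring
  have hγt : scgsGamma t = 3 / ((t : ℝ) + 2) := by rw [scgsGamma]
  have ht3 : (0 : ℝ) < (t : ℝ) + 3 := by positivity
  have hz := hrun.z_eq (t + 1) (by omega) ht ω
  rw [Nat.add_sub_cancel] at hz
  have hc := hprob.convexOn.2 hx hy (sub_nonneg.2 (scgsGamma_le_one (t := t + 1) (by omega)))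
    scgsGamma_nonneg (by ring)
  rw [← hz, ← hf] at hc
  simp only [smul_eq_mul] at hc
  have hfy := gap_le_of_smooth hprob.convex hprob.diam_le hL.le hprob.differentiableAt
    hprob.lipschitz_grad hsol.mem hy
  -- Applied to `x_t = (1 - γ_t) x_{t-1} + γ_t y_t`: the linearization at `x*` of the gap at `y_t`
  -- is at most `(t+2)/3` times the gap at `x_t`. The hypothesis `1 ≤ t` is essential, since `y 0`
  -- is not a component of an earlier averaging step.
  have hin := inner_gradient_le_gap hprob.convex hprob.convexOn
    (hprob.differentiableAt _ hsol.mem) hsol.mem hsol.le (hm (t - 1) (by omega)).1 hy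
    scgsGamma_nonneg (scgsGamma_le_one h1)
  rw [← hrun.x_eq t h1 (by omega) ω, hγt, div_mul_eq_mul_div, div_le_iff₀ (by positivity)] at hin
  rw [← hf] at hfy hin
  rw [hγ] at hc
  have e1 : 1 - 3 / ((t : ℝ) + 3) = t / (t + 3) := by field_simp; ring
  rw [e1] at hc
  have hin' : 3 / ((t : ℝ) + 3) * ⟪gradient f xs, y t ω - xs⟫
      ≤ (t + 2) / (t + 3) * (f (x t ω) - f xs) := by
    rw [div_mul_eq_mul_div, div_mul_eq_mul_div]
    exact div_le_div_of_nonneg_right (by linarith) ht3.le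
  have hfy' := mul_le_mul_of_nonneg_left hfy (show (0 : ℝ) ≤ 3 / ((t : ℝ) + 3) by positivity)
  have e2 : 2 * ((t : ℝ) + 1) / (t + 3) = t / (t + 3) + (t + 2) / (t + 3) := by field_simp; ring
  have e3 : f xs = t / ((t : ℝ) + 3) * f xs + 3 / (t + 3) * f xs := by field_simp
  rw [e2]
  linarith

variable [IsProbabilityMeasure smp] [IsProbabilityMeasure P] [SFinite μ]

theorem measurable_objective (hF : Measurable (fun p : EuclideanSpace ℝ (Fin d) × Ξ => F p.1 p.2)) :
    Measurable (objective F μ) :=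
  (StronglyMeasurable.integral_prod_right' (ν := μ) hF.stronglyMeasurable).measurable

theorem integrable_gap (hL : 0 < L) (hprob : ConvexSmoothProblem K F μ L D)
    (hsol : IsSolution K F μ xs) {w : Ω → EuclideanSpace ℝ (Fin d)} (hw : Measurable w)
    (hwK : ∀ ω, w ω ∈ K) : Integrable (fun ω => objective F μ (w ω) - objective F μ xs) P := by
  refine (integrable_const (‖gradient (objective F μ) xs‖ * D + L * D ^ 2 / 2)).mono'
    (((measurable_objective hprob.measurable).comp hw).sub_const _).aestronglyMeasurable
    (Filter.Eventually.of_forall fun ω => ?_)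
  rw [Real.norm_of_nonneg (sub_nonneg.2 (hsol.le _ (hwK ω)))]
  exact gap_le_norm_gradient hprob.convex hprob.diam_le hL.le hprob.differentiableAt
    hprob.lipschitz_grad hsol.mem (hwK ω)

/-- The expected one-step inequality. -/
theorem expected_step (hL : 0 < L) (hD : 0 < D) (hprob : ConvexSmoothProblem K F μ L D)
    (hsol : IsSolution K F μ xs)
    (hrun : IsSCGSRun K G smp (scgsBeta L) scgsGamma (scgsEta L D) b T P ℱ s x y z g p q)
    (hG : Measurable (fun p : EuclideanSpace ℝ (Fin d) × S => G p.1 p.2))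
    (hint : ∀ x ∈ K, Integrable (G x) smp) {B σ v : ℝ} (hv : 0 ≤ v)
    (hbias : ∀ x ∈ K, ‖∫ s, G x s ∂smp - gradient (objective F μ) x‖ ≤ B)
    (hvar : ∀ x ∈ K, Integrable (fun s => ‖G x s - ∫ s, G x s ∂smp‖ ^ 2) smp ∧
      ∫ s, ‖G x s - ∫ s, G x s ∂smp‖ ^ 2 ∂smp
        ≤ σ * (objective F μ x - objective F μ xs) + v)
    {t : ℕ} (ht : t + 1 ≤ T) (hb : 1 ≤ b (t + 1))
    (hbσ : σ * (3 * (t + 1) * (t + 2)) ≤ 2 * L * b (t + 1)) :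
    ((t : ℝ) + 1) * (t + 2) * (t + 3)
          * ∫ ω, (objective F μ (x (t + 1) ω) - objective F μ xs) ∂P
        + 6 * L * (t + 1) * (t + 2) / (t + 3) * ∫ ω, ‖y (t + 1) ω - xs‖ ^ 2 ∂P
      ≤ (t : ℝ) * (t + 1) * (t + 2) * ∫ ω, (objective F μ (x t ω) - objective F μ xs) ∂P
        + 6 * L * (t + 1) * (t + 2) / (t + 3) * ∫ ω, ‖y t ω - xs‖ ^ 2 ∂P
        + 3 * (L * D ^ 2)
        + (t + 3) * ∫ ω, (objective F μ (z (t + 1) ω) - objective F μ xs) ∂P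
        + (t + 1) * (t + 2) * (t + 3) * (3 * v / (2 * L)) + 3 * (t + 1) * (t + 2) * (B * D) := by
  have h1 : 1 ≤ t + 1 := by omega
  have hKm : MeasurableSet K := hprob.isClosed.measurableSet
  have hmem := fun ω r hr => hrun.mem hL hD hprob.convex hprob.diam_le ω r hr
  have hzK := fun ω => hrun.z_mem hL hD hprob.convex hprob.diam_le h1 ht ω
  have hxm : ∀ r, r ≤ T → Measurable (x r) := fun r hr =>
    (hrun.measurable_x r hr).mono (ℱ.le r) le_rfl
  have hym : ∀ r, r ≤ T → Measurable (y r) := fun r hr =>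
    (hrun.adapted r hr).mono (ℱ.le r) le_rfl
  have hzm := hrun.measurable_z h1 ht
  have hzm' : Measurable (z (t + 1)) := hzm.mono (ℱ.le _) le_rfl
  set f := objective F μ with hf
  have hx1I : Integrable (fun ω => f (x (t + 1) ω) - f xs) P :=
    integrable_gap hL hprob hsol (hxm _ ht) fun ω => (hmem ω _ ht).1
  have hx0I : Integrable (fun ω => f (x t ω) - f xs) P :=
    integrable_gap hL hprob hsol (hxm _ (by omega)) fun ω => (hmem ω _ (by omega)).1
  have hzI : Integrable (fun ω => f (z (t + 1) ω) - f xs) P :=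
    integrable_gap hL hprob hsol hzm' hzK
  have hRI : ∀ r, r ≤ T → Integrable (fun ω => ‖y r ω - xs‖ ^ 2) P := fun r hr => by
    refine (integrable_const (D ^ 2)).mono'
      ((((hym r hr).sub_const xs).norm.pow_const 2).aestronglyMeasurable)
      (Filter.Eventually.of_forall fun ω => ?_)
    rw [norm_pow, norm_norm]
    have := hprob.diam_le _ (hmem ω r hr).2 _ hsol.mem
    gcongr
  have hym0 : Measurable[ℱ (t + 1 - 1)] (fun ω => y t ω - xs) :=
    (hrun.adapted t (by omega)).sub_const xs
  obtain ⟨hE2I, hE2, hEiI, hEi⟩ := batch_estimate (ℱ.le (t + 1 - 1)) hKm hG hb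
    (hrun.sample_measurable _ h1 ht) (hrun.sample_dist _ h1 ht) (hrun.sample_iIndep _ h1 ht)
    (hrun.sample_indep_past _ h1 ht) hzm hym0 hzK
    (fun ω => hprob.diam_le _ (hmem ω t (by omega)).2 _ hsol.mem) hint hvar
    ((hzI.const_mul σ).add (integrable_const v))
  set ε : Ω → EuclideanSpace ℝ (Fin d) :=
    fun ω => batchError G smp (z (t + 1) ω) (fun i => s (t + 1) i ω) with hε
  have hpath : ∀ ω, f (x (t + 1) ω) - f xs ≤
      (1 - scgsGamma (t + 1)) * (f (x t ω) - f xs) + scgsGamma (t + 1) * scgsEta L D (t + 1)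
      + scgsGamma (t + 1) * scgsBeta L (t + 1) / 2 * (‖y t ω - xs‖ ^ 2 - ‖y (t + 1) ω - xs‖ ^ 2)
      + scgsGamma (t + 1) / (2 * (scgsBeta L (t + 1) - L * scgsGamma (t + 1))) * ‖ε ω‖ ^ 2
      - scgsGamma (t + 1) * ⟪ε ω, y t ω - xs⟫ + scgsGamma (t + 1) * (B * D) := by
    intro ω
    have hεω : ε ω = g (t + 1) ω - ∫ s, G (z (t + 1) ω) s ∂smp := by
      rw [hε, hrun.g_eq (t + 1) h1 ht ω]; rfl
    rw [hεω]
    refine sliding_step hprob.convex hprob.diam_le hprob.convexOn hprob.differentiableAt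
      hprob.lipschitz_grad hsol.mem (hmem ω t (by omega)).1 (hmem ω t (by omega)).2
      (hmem ω _ ht).2 scgsGamma_nonneg (scgsGamma_le_one h1) ?_ (hrun.z_eq _ h1 ht ω)
      (hrun.x_eq _ h1 ht ω) (hrun.gap_le hL hD hprob.convex hprob.diam_le h1 ht ω hsol.mem)
      (hbias _ (hzK ω))
    have := scgsBeta_sub (L := L) (t + 1)
    have h2 : 0 < L / (((t + 1 : ℕ) : ℝ) + 2) := by positivity
    linarith
  have hγ : scgsGamma (t + 1) = 3 / ((t : ℝ) + 3) := by rw [scgsGamma]; push_cast; ring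
  have hβ : scgsBeta L (t + 1) = 4 * L / ((t : ℝ) + 3) := by rw [scgsBeta]; push_cast; ring
  have hη : scgsEta L D (t + 1) = L * D ^ 2 / (((t : ℝ) + 1) * (t + 2)) := by
    rw [scgsEta]; push_cast; ring
  have hA : (0 : ℝ) < (t + 1) * (t + 2) * (t + 3) := by positivity
  set c := 6 * L * (t + 1) * (t + 2) / ((t : ℝ) + 3) with hc
  -- Multiplying by `(t+1)(t+2)(t+3)` turns the contraction factor `1 - γ = t/(t+3)` into the
  -- previous weight `t(t+1)(t+2)`, and turns `γ η` into the constant `3 L D²`.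
  have hpath' : ∀ ω, ((t : ℝ) + 1) * (t + 2) * (t + 3) * (f (x (t + 1) ω) - f xs)
      + c * ‖y (t + 1) ω - xs‖ ^ 2 ≤
      (t : ℝ) * (t + 1) * (t + 2) * (f (x t ω) - f xs) + c * ‖y t ω - xs‖ ^ 2
      + 3 * (t + 1) * (t + 2) * (t + 3) / (2 * L) * ‖ε ω‖ ^ 2
      - 3 * (t + 1) * (t + 2) * ⟪ε ω, y t ω - xs⟫
      + (3 * (L * D ^ 2) + 3 * (t + 1) * (t + 2) * (B * D)) := by
    intro ω
    have h := mul_le_mul_of_nonneg_left (hpath ω) hA.le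
    rw [hγ, hβ, hη] at h
    have e : ((t : ℝ) + 1) * (t + 2) * (t + 3) * ((1 - 3 / ((t : ℝ) + 3)) * (f (x t ω) - f xs)
      + 3 / ((t : ℝ) + 3) * (L * D ^ 2 / (((t : ℝ) + 1) * (t + 2)))
      + 3 / ((t : ℝ) + 3) * (4 * L / ((t : ℝ) + 3)) / 2
        * (‖y t ω - xs‖ ^ 2 - ‖y (t + 1) ω - xs‖ ^ 2)
      + 3 / ((t : ℝ) + 3) / (2 * (4 * L / ((t : ℝ) + 3) - L * (3 / ((t : ℝ) + 3)))) * ‖ε ω‖ ^ 2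
      - 3 / ((t : ℝ) + 3) * ⟪ε ω, y t ω - xs⟫ + 3 / ((t : ℝ) + 3) * (B * D))
      = (t : ℝ) * (t + 1) * (t + 2) * (f (x t ω) - f xs)
      + c * (‖y t ω - xs‖ ^ 2 - ‖y (t + 1) ω - xs‖ ^ 2)
      + 3 * (t + 1) * (t + 2) * (t + 3) / (2 * L) * ‖ε ω‖ ^ 2
      - 3 * (t + 1) * (t + 2) * ⟪ε ω, y t ω - xs⟫
      + (3 * (L * D ^ 2) + 3 * (t + 1) * (t + 2) * (B * D)) := by
      have e1 : 4 * L / ((t : ℝ) + 3) - L * (3 / ((t : ℝ) + 3)) = L / (t + 3) := by ring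
      have e2 : 1 - 3 / ((t : ℝ) + 3) = t / (t + 3) := by field_simp; ring
      rw [e1, e2, hc]
      field_simp
      ring
    rw [e] at h
    linarith
  have hmain := integral_mono_linear hx1I (hRI _ ht) hx0I (hRI t (by omega)) hE2I hEiI hpath'
  rw [hEi] at hmain
  have hZ0 : 0 ≤ ∫ ω, (f (z (t + 1) ω) - f xs) ∂P :=
    integral_nonneg fun ω => sub_nonneg.2 (hsol.le _ (hzK ω))
  rw [integral_add (hzI.const_mul σ) (integrable_const v), integral_const_mul] at hE2
  simp only [integral_const, probReal_univ, one_smul] at hE2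
  have hb1 : (1 : ℝ) ≤ b (t + 1) := by exact_mod_cast hb
  have hb0 : (0 : ℝ) < b (t + 1) := by linarith
  -- This is where the batch size is used: after multiplication by the noise weight, the gap at `z`
  -- keeps only the coefficient `t + 3`. The constant variance `v` needs no averaging and is kept
  -- whole.
  have hσ : ((b (t + 1) : ℝ))⁻¹ * σ ≤ 2 * L / (3 * (t + 1) * (t + 2)) := by
    rw [inv_mul_le_iff₀ hb0, ← mul_div_assoc, le_div_iff₀ (by positivity)]
    linarith
  have hv' : ((b (t + 1) : ℝ))⁻¹ * v ≤ v := by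
    rw [inv_mul_le_iff₀ hb0]; nlinarith
  have hE3 : ∫ ω, ‖ε ω‖ ^ 2 ∂P
      ≤ 2 * L / (3 * (t + 1) * (t + 2)) * ∫ ω, (f (z (t + 1) ω) - f xs) ∂P + v := by
    have := mul_le_mul_of_nonneg_right hσ hZ0
    linarith
  have hE4 := mul_le_mul_of_nonneg_left hE3
    (show 0 ≤ 3 * ((t : ℝ) + 1) * (t + 2) * (t + 3) / (2 * L) by positivity)
  have e5 : 3 * ((t : ℝ) + 1) * (t + 2) * (t + 3) / (2 * L)
      * (2 * L / (3 * (t + 1) * (t + 2)) * ∫ ω, (f (z (t + 1) ω) - f xs) ∂P + v)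
      = (t + 3) * ∫ ω, (f (z (t + 1) ω) - f xs) ∂P
        + (t + 1) * (t + 2) * (t + 3) * (3 * v / (2 * L)) := by
    field_simp
  rw [e5] at hE4
  linarith

/-- Convergence rate of stochastic conditional gradient sliding for a gradient estimator with
bias at most `B` and variance at most `σ (f - f*) + v`. -/
theorem rate (hL : 0 < L) (hD : 0 < D) (hprob : ConvexSmoothProblem K F μ L D)
    (hsol : IsSolution K F μ xs)
    (hrun : IsSCGSRun K G smp (scgsBeta L) scgsGamma (scgsEta L D) b T P ℱ s x y z g p q)
    (hG : Measurable (fun p : EuclideanSpace ℝ (Fin d) × S => G p.1 p.2))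
    (hint : ∀ x ∈ K, Integrable (G x) smp) {B σ v e lam κ : ℝ} (hv : 0 ≤ v)
    (hbias : ∀ x ∈ K, ‖∫ s, G x s ∂smp - gradient (objective F μ) x‖ ≤ B)
    (hvar : ∀ x ∈ K, Integrable (fun s => ‖G x s - ∫ s, G x s ∂smp‖ ^ 2) smp ∧
      ∫ s, ‖G x s - ∫ s, G x s ∂smp‖ ^ 2 ∂smp
        ≤ σ * (objective F μ x - objective F μ xs) + v)
    (hb : ∀ t, 1 ≤ t → 1 ≤ b t)
    (hbσ : ∀ t : ℕ, σ * (3 * (t + 1) * (t + 2)) ≤ 2 * L * b (t + 1))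
    (herr : ∀ t : ℕ, t + 1 ≤ T → ((t : ℝ) + 1) * (t + 2) * (t + 3) * (3 * v / (2 * L))
      + 3 * (t + 1) * (t + 2) * (B * D) ≤ (e - 9 / 2) * (L * D ^ 2))
    (hκ0 : 0 ≤ κ) (hκ : e + κ ≤ lam) (hlam1 : 1 ≤ lam)
    (hlam : ∀ k : ℕ, 1 ≤ k → 2 * (lam * k - κ + 6 * k) ≤ (lam - e) * (k * (k + 2)))
    {t : ℕ} (ht : t ≤ T) :
    Integrable (fun ω => objective F μ (x t ω) - objective F μ xs) P ∧
    ∫ ω, (objective F μ (x t ω) - objective F μ xs) ∂P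
      ≤ 6 * L * D ^ 2 / ((t : ℝ) + 2) ^ 2
        + (lam * L * D ^ 2 + 3 * (‖gradient (objective F μ) xs‖ * D))
          / (((t : ℝ) + 1) * ((t : ℝ) + 2)) := by
  have hmem := fun ω r hr => hrun.mem hL hD hprob.convex hprob.diam_le ω r hr
  have hxm : ∀ r, r ≤ T → Measurable (x r) := fun r hr =>
    (hrun.measurable_x r hr).mono (ℱ.le r) le_rfl
  have hym : ∀ r, r ≤ T → Measurable (y r) := fun r hr =>
    (hrun.adapted r hr).mono (ℱ.le r) le_rfl
  have hI : ∀ r, r ≤ T → Integrable (fun ω => objective F μ (x r ω) - objective F μ xs) P :=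
    fun r hr => integrable_gap hL hprob hsol (hxm r hr) fun ω => (hmem ω r hr).1
  have hzI : ∀ r, r + 1 ≤ T →
      Integrable (fun ω => objective F μ (z (r + 1) ω) - objective F μ xs) P := fun r hr =>
    integrable_gap hL hprob hsol ((hrun.measurable_z (by omega) hr).mono (ℱ.le _) le_rfl)
      fun ω => hrun.z_mem hL hD hprob.convex hprob.diam_le (by omega) hr ω
  have hgap := fun w (hw : w ∈ K) => gap_le_norm_gradient hprob.convex hprob.diam_le hL.le
    hprob.differentiableAt hprob.lipschitz_grad hsol.mem hw
  set N := ‖gradient (objective F μ) xs‖ * D with hN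
  have hN0 : 0 ≤ N := by positivity
  have hLD : 0 ≤ L * D ^ 2 := by positivity
  refine ⟨hI t ht, ?_⟩
  rcases Nat.eq_zero_or_pos t with rfl | hpos
  · have h1 : ∫ ω, (objective F μ (x 0 ω) - objective F μ xs) ∂P ≤ N + L * D ^ 2 / 2 := by
      refine (integral_mono (hI 0 ht) (integrable_const _) fun ω => hgap _ (hmem ω 0 ht).1).trans ?_
      simp
    refine h1.trans ?_
    norm_num
    nlinarith
  · have hrec := weighted_recursion (Δ := fun r => ∫ ω, (objective F μ (x r ω) - objective F μ xs) ∂P)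
      (R := fun r => ∫ ω, ‖y r ω - xs‖ ^ 2 ∂P) (L := L) (D := D) (N := N) (e := e) (lam := lam)
      (κ := κ) (T := T) hL.le hN0 (fun k _ => integral_nonneg fun ω => by positivity)
      (fun k hk => ?_) (fun hT => ?_) (fun k hk hkT => ?_) hκ hlam t hpos ht
    · exact gap_bound_of_weighted hpos hL.le hκ0
        (integral_nonneg fun ω => by positivity) hrec
    · have h0 : ∀ ω, ‖y k ω - xs‖ ^ 2 ≤ D ^ 2 := fun ω => by
        have := hprob.diam_le _ (hmem ω k hk).2 _ hsol.mem
        gcongr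
      refine (integral_mono_of_nonneg (Filter.Eventually.of_forall fun ω => by positivity)
        (integrable_const (D ^ 2)) (Filter.Eventually.of_forall h0)).trans ?_
      simp
    · have h := hrun.expected_step hL hD hprob hsol hG hint hv hbias hvar (t := 0) hT
        (hb _ le_rfl) (hbσ 0)
      have he := herr 0 hT
      -- No averaging step precedes the first iteration, so the gap at `z` is bounded by smoothness
      -- and the diameter alone. This is the only way `N` enters the recursion.
      have hz : ∫ ω, (objective F μ (z (0 + 1) ω) - objective F μ xs) ∂P ≤ N + L * D ^ 2 / 2 := by
        refine (integral_mono (hzI 0 hT) (integrable_const _) fun ω =>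
          hgap _ (hrun.z_mem hL hD hprob.convex hprob.diam_le (by omega) hT ω)).trans ?_
        simp
      norm_num at h he hz ⊢
      linarith
    · have h := hrun.expected_step hL hD hprob hsol hG hint hv hbias hvar hkT
        (hb _ (by omega)) (hbσ k)
      have he := herr k hkT
      -- After multiplication by `k + 3` this gives `2(k+1) Δ_k + (3/2) L D²`. The `3/2`, together
      -- with the `3` from the LMO tolerance, is the `9/2` subtracted from `e` in `herr`.
      have hz : ∫ ω, (objective F μ (z (k + 1) ω) - objective F μ xs) ∂P
          ≤ 2 * (k + 1) / (k + 3) * ∫ ω, (objective F μ (x k ω) - objective F μ xs) ∂P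
            + 3 / (k + 3) * (L * D ^ 2 / 2) := by
        refine (integral_mono (hzI k hkT) (((hI k (by omega)).const_mul _).add
          (integrable_const _)) fun ω => hrun.gap_z_le hL hD hprob hsol hk hkT ω).trans ?_
        simp only [Pi.add_apply]
        rw [integral_add ((hI k (by omega)).const_mul _) (integrable_const _), integral_const_mul]
        simp
      have hz' := mul_le_mul_of_nonneg_left hz (show (0 : ℝ) ≤ (k : ℝ) + 3 by positivity)
      have e1 : ((k : ℝ) + 3) * (2 * (k + 1) / (k + 3)
            * ∫ ω, (objective F μ (x k ω) - objective F μ xs) ∂P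
            + 3 / (k + 3) * (L * D ^ 2 / 2))
          = 2 * (k + 1) * ∫ ω, (objective F μ (x k ω) - objective F μ xs) ∂P
            + 3 / 2 * (L * D ^ 2) := by
        field_simp
      rw [e1] at hz'
      linarith

end Rate

end IsSCGSRun

/-! ### Moments of the standard Gaussian -/

section GaussianMoments

-- Derivatives of the Gaussian moment generating function are a polynomial times the same
-- exponential, and the polynomials obey a simple recursion. Evaluating at `0` reduces each moment
-- to a finite computation.
open Polynomial in
theorem iteratedDeriv_exp_sq (v : ℝ) (n : ℕ) :
    iteratedDeriv n (fun t : ℝ => Real.exp (v * t ^ 2 / 2))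
      = fun t => ((fun r : ℝ[X] => derivative r + C v * X * r)^[n] 1).eval t
          * Real.exp (v * t ^ 2 / 2) := by
  induction n with
  | zero => simp
  | succ n ih =>
    rw [iteratedDeriv_succ, ih]
    funext t
    rw [Function.iterate_succ_apply']
    set r := (fun r : ℝ[X] => derivative r + C v * X * r)^[n] 1
    have h1 : HasDerivAt (fun t : ℝ => v * t ^ 2 / 2) (v * t) t := by
      refine (((hasDerivAt_pow 2 t).const_mul v).div_const 2).congr_deriv ?_
      simp
      ring
    have h2 := (r.hasDerivAt t).mul h1.exp
    refine h2.deriv.trans ?_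
    simp only [eval_add, eval_mul, eval_C, eval_X]
    ring

theorem integral_pow_gaussianReal (v : NNReal) (n : ℕ) :
    ∫ x, x ^ n ∂(gaussianReal 0 v) = iteratedDeriv n (fun t : ℝ => Real.exp (v * t ^ 2 / 2)) 0 := by
  have h := iteratedDeriv_mgf_zero (X := id) (μ := gaussianReal 0 v)
    (by rw [integrableExpSet_id_gaussianReal]; simp) n
  rw [mgf_id_gaussianReal] at h
  simpa using h.symm

theorem integral_pow_two_gaussianReal (v : NNReal) : ∫ x, x ^ 2 ∂(gaussianReal 0 v) = v := by
  rw [integral_pow_gaussianReal, iteratedDeriv_exp_sq]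
  simp [Function.iterate_succ_apply']

theorem integral_pow_four_gaussianReal (v : NNReal) :
    ∫ x, x ^ 4 ∂(gaussianReal 0 v) = 3 * (v : ℝ) ^ 2 := by
  rw [integral_pow_gaussianReal, iteratedDeriv_exp_sq]
  simp [Function.iterate_succ_apply']
  ring

theorem integral_pow_six_gaussianReal (v : NNReal) :
    ∫ x, x ^ 6 ∂(gaussianReal 0 v) = 15 * (v : ℝ) ^ 3 := by
  rw [integral_pow_gaussianReal, iteratedDeriv_exp_sq]
  simp [Function.iterate_succ_apply']
  ring

variable {E : Type*} [NormedAddCommGroup E] [InnerProductSpace ℝ E] [FiniteDimensional ℝ E]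
  [MeasurableSpace E] [BorelSpace E]

theorem map_inner_stdGaussian (w : E) :
    (stdGaussian E).map (fun u => ⟪w, u⟫) = gaussianReal 0 (‖w‖ ^ 2).toNNReal := by
  have h := IsGaussian.map_eq_gaussianReal (μ := stdGaussian E) (innerSL ℝ w)
  rw [integral_strongDual_stdGaussian, variance_dual_stdGaussian, innerSL_apply_norm] at h
  exact h

theorem integral_inner_pow_stdGaussian (w : E) (n : ℕ) :
    ∫ u, ⟪w, u⟫ ^ n ∂(stdGaussian E) = ∫ x, x ^ n ∂(gaussianReal 0 (‖w‖ ^ 2).toNNReal) := by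
  rw [← map_inner_stdGaussian, integral_map (by fun_prop) (by fun_prop)]

theorem integral_inner_pow_two (w : E) : ∫ u, ⟪w, u⟫ ^ 2 ∂(stdGaussian E) = ‖w‖ ^ 2 := by
  rw [integral_inner_pow_stdGaussian, integral_pow_two_gaussianReal,
    Real.coe_toNNReal _ (by positivity)]

theorem integral_inner_pow_four (w : E) : ∫ u, ⟪w, u⟫ ^ 4 ∂(stdGaussian E) = 3 * ‖w‖ ^ 4 := by
  rw [integral_inner_pow_stdGaussian, integral_pow_four_gaussianReal,
    Real.coe_toNNReal _ (by positivity)]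
  ring

theorem integral_inner_pow_six (w : E) : ∫ u, ⟪w, u⟫ ^ 6 ∂(stdGaussian E) = 15 * ‖w‖ ^ 6 := by
  rw [integral_inner_pow_stdGaussian, integral_pow_six_gaussianReal,
    Real.coe_toNNReal _ (by positivity)]
  ring

theorem integrable_norm_pow_stdGaussian (n : ℕ) :
    Integrable (fun u : E => ‖u‖ ^ n) (stdGaussian E) :=
  (IsGaussian.memLp_id (stdGaussian E) n (by simp)).integrable_norm_pow'

theorem integrable_inner_pow_stdGaussian (w : E) (n : ℕ) :
    Integrable (fun u : E => ⟪w, u⟫ ^ n) (stdGaussian E) := by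
  refine ((integrable_norm_pow_stdGaussian n).const_mul (‖w‖ ^ n)).mono' (by fun_prop)
    (Filter.Eventually.of_forall fun u => ?_)
  rw [norm_pow, ← mul_pow]
  gcongr
  exact norm_inner_le_norm w u

theorem integral_inner_mul_inner (v w : E) :
    ∫ u, ⟪v, u⟫ * ⟪w, u⟫ ∂(stdGaussian E) = ⟪v, w⟫ := by
  have h : ∀ u : E, ⟪v, u⟫ * ⟪w, u⟫ = 1 / 4 * (⟪v + w, u⟫ ^ 2 - ⟪v - w, u⟫ ^ 2) := fun u => by
    rw [inner_add_left, inner_sub_left]; ring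
  simp_rw [h]
  rw [integral_const_mul, integral_sub (integrable_inner_pow_stdGaussian _ 2)
    (integrable_inner_pow_stdGaussian _ 2), integral_inner_pow_two, integral_inner_pow_two,
    norm_add_sq_real, norm_sub_sq_real]
  ring

/-- Polarization expresses the mixed fourth moment through fourth powers of one-dimensional
marginals. -/
theorem integral_inner_sq_mul_inner_sq (v w : E) :
    ∫ u, ⟪v, u⟫ ^ 2 * ⟪w, u⟫ ^ 2 ∂(stdGaussian E) = ‖v‖ ^ 2 * ‖w‖ ^ 2 + 2 * ⟪v, w⟫ ^ 2 := by
  have h : ∀ u : E, ⟪v, u⟫ ^ 2 * ⟪w, u⟫ ^ 2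
      = 1 / 12 * (⟪v + w, u⟫ ^ 4 + ⟪v - w, u⟫ ^ 4 - 2 * ⟪v, u⟫ ^ 4 - 2 * ⟪w, u⟫ ^ 4) := fun u => by
    rw [inner_add_left, inner_sub_left]; ring
  have hi := fun r : E => integrable_inner_pow_stdGaussian r 4
  simp_rw [h]
  have h1 : Integrable (fun u : E => ⟪v + w, u⟫ ^ 4 + ⟪v - w, u⟫ ^ 4) (stdGaussian E) :=
    (hi _).add (hi _)
  have h2 : Integrable (fun u : E => ⟪v + w, u⟫ ^ 4 + ⟪v - w, u⟫ ^ 4 - 2 * ⟪v, u⟫ ^ 4)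
    (stdGaussian E) := h1.sub ((hi v).const_mul 2)
  rw [integral_const_mul, integral_sub h2 ((hi w).const_mul 2),
    integral_sub h1 ((hi v).const_mul 2), integral_add (hi _) (hi _), integral_const_mul,
    integral_const_mul, integral_inner_pow_four, integral_inner_pow_four, integral_inner_pow_four,
    integral_inner_pow_four]
  have e1 : ‖v + w‖ ^ 4 = (‖v‖ ^ 2 + 2 * ⟪v, w⟫ + ‖w‖ ^ 2) ^ 2 := by
    rw [← norm_add_sq_real]; ring
  have e2 : ‖v - w‖ ^ 4 = (‖v‖ ^ 2 - 2 * ⟪v, w⟫ + ‖w‖ ^ 2) ^ 2 := by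
    rw [← norm_sub_sq_real]; ring
  rw [e1, e2]
  ring

theorem integrable_inner_sq_mul_norm_sq (v : E) :
    Integrable (fun u => ⟪v, u⟫ ^ 2 * ‖u‖ ^ 2) (stdGaussian E) := by
  refine ((integrable_norm_pow_stdGaussian 4).const_mul (‖v‖ ^ 2)).mono' (by fun_prop)
    (Filter.Eventually.of_forall fun u => ?_)
  have h := norm_inner_le_norm (𝕜 := ℝ) v u
  rw [Real.norm_of_nonneg (by positivity), ← sq_abs, ← Real.norm_eq_abs]
  calc ‖⟪v, u⟫‖ ^ 2 * ‖u‖ ^ 2 ≤ (‖v‖ * ‖u‖) ^ 2 * ‖u‖ ^ 2 := by gcongr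
    _ = ‖v‖ ^ 2 * ‖u‖ ^ 4 := by ring

theorem integral_inner_smul (v : E) : ∫ u, ⟪v, u⟫ • u ∂(stdGaussian E) = v := by
  have hI : Integrable (fun u : E => ⟪v, u⟫ • u) (stdGaussian E) := by
    refine ((integrable_norm_pow_stdGaussian 2).const_mul ‖v‖).mono' (by fun_prop)
      (Filter.Eventually.of_forall fun u => ?_)
    rw [norm_smul]
    calc ‖⟪v, u⟫‖ * ‖u‖ ≤ ‖v‖ * ‖u‖ * ‖u‖ := by gcongr; exact norm_inner_le_norm v u
      _ = ‖v‖ * ‖u‖ ^ 2 := by ring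
  refine ext_inner_left ℝ fun w => ?_
  rw [← integral_inner hI]
  simp_rw [inner_smul_right]
  rw [integral_inner_mul_inner, real_inner_comm]

variable {d : ℕ}

/-- Expand `‖u‖²` in an orthonormal basis: each of the `d` coordinates contributes `‖v‖²`, and the
correlation terms add up to `2‖v‖²`. This is the source of the dimension factor in the zeroth-order
variance. -/
theorem integral_inner_sq_mul_norm_sq (v : EuclideanSpace ℝ (Fin d)) :
    ∫ u, ⟪v, u⟫ ^ 2 * ‖u‖ ^ 2 ∂(stdGaussian (EuclideanSpace ℝ (Fin d))) = (d + 2) * ‖v‖ ^ 2 := by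
  set B := EuclideanSpace.basisFun (Fin d) ℝ
  have h : ∀ u : EuclideanSpace ℝ (Fin d), ⟪v, u⟫ ^ 2 * ‖u‖ ^ 2
      = ∑ k, ⟪v, u⟫ ^ 2 * ⟪B k, u⟫ ^ 2 := fun u => by
    rw [← Finset.mul_sum, B.sum_sq_inner_right]
  have hI : ∀ k, Integrable (fun u => ⟪v, u⟫ ^ 2 * ⟪B k, u⟫ ^ 2)
      (stdGaussian (EuclideanSpace ℝ (Fin d))) := fun k => by
    refine (integrable_inner_sq_mul_norm_sq v).mono' (by fun_prop)
      (Filter.Eventually.of_forall fun u => ?_)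
    have h1 := norm_inner_le_norm (𝕜 := ℝ) (B k) u
    rw [B.norm_eq_one, one_mul] at h1
    rw [Real.norm_of_nonneg (by positivity), ← sq_abs ⟪B k, u⟫, ← Real.norm_eq_abs]
    gcongr
  simp_rw [h]
  rw [integral_finsetSum _ fun k _ => hI k]
  simp_rw [integral_inner_sq_mul_inner_sq, B.norm_eq_one]
  rw [Finset.sum_add_distrib, ← Finset.mul_sum, ← Finset.mul_sum, B.sum_sq_inner_left]
  simp
  ring

/-- The power mean inequality replaces the cube of a sum of `d` squares by `d²` times the sum of
sixth powers, leaving only one-dimensional moments. -/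
theorem integral_norm_pow_six_le :
    ∫ u, ‖u‖ ^ 6 ∂(stdGaussian (EuclideanSpace ℝ (Fin d))) ≤ 15 * (d : ℝ) ^ 3 := by
  set B := EuclideanSpace.basisFun (Fin d) ℝ
  have hI : ∀ k, Integrable (fun u => ⟪B k, u⟫ ^ 6) (stdGaussian (EuclideanSpace ℝ (Fin d))) :=
    fun k => integrable_inner_pow_stdGaussian _ 6
  have h : ∀ u : EuclideanSpace ℝ (Fin d), ‖u‖ ^ 6 ≤ (d : ℝ) ^ 2 * ∑ k, ⟪B k, u⟫ ^ 6 := fun u => by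
    rcases Nat.eq_zero_or_pos d with rfl | hd
    · simp [Subsingleton.elim u 0]
    · have hd' : (0 : ℝ) < d := by exact_mod_cast hd
      have h1 := pow_sum_div_card_le_sum_pow (s := Finset.univ)
        (f := fun k => ⟪B k, u⟫ ^ 2) (fun k _ => by positivity) 2
      rw [B.sum_sq_inner_right, div_le_iff₀ (by simpa using by positivity)] at h1
      simp only [← pow_mul, Finset.card_univ, Fintype.card_fin, Nat.reduceMul, Nat.reduceAdd] at h1
      linarith
  refine (integral_mono (integrable_norm_pow_stdGaussian 6)
    ((integrable_finsetSum _ fun k _ => hI k).const_mul _) h).trans (le_of_eq ?_)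
  rw [integral_const_mul, integral_finsetSum _ fun k _ => hI k]
  simp_rw [integral_inner_pow_six, B.norm_eq_one]
  simp
  ring

end GaussianMoments

/-! ### Gaussian smoothing: bias and second moment -/

section ZerothOrder

/-- Quadratic Taylor estimate for a function with a globally Lipschitz gradient. -/
theorem abs_sub_inner_gradient_le {E : Type*} [NormedAddCommGroup E] [InnerProductSpace ℝ E]
    [CompleteSpace E] {f : E → ℝ} {L : ℝ} (hd : Differentiable ℝ f)
    (hlip : ∀ x y, ‖gradient f x - gradient f y‖ ≤ L * ‖x - y‖) (x y : E) :
    |f y - f x - ⟪gradient f x, y - x⟫| ≤ L / 2 * ‖y - x‖ ^ 2 := by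
  have h1 := descent_on_convex convex_univ (fun x _ => hd x) (fun x _ y _ => hlip x y)
    (Set.mem_univ x) (Set.mem_univ y)
  have hneg : ∀ w, gradient (fun r => -f r) w = -gradient f w := fun w => by
    simp only [gradient, fderiv_fun_neg, map_neg]
  have h2 := descent_on_convex (f := fun r => -f r) (L := L) convex_univ (fun x _ => (hd x).neg)
    (fun x _ y _ => by
      rw [hneg, hneg, ← neg_sub', norm_neg]
      exact hlip x y) (Set.mem_univ x) (Set.mem_univ y)
  rw [hneg, inner_neg_left] at h2
  exact abs_le.2 ⟨by linarith, by linarith⟩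

variable {d : ℕ} {Ξ : Type u} [MeasurableSpace Ξ]
  {F : EuclideanSpace ℝ (Fin d) → Ξ → ℝ} {μ : Measure Ξ} {L : ℝ}

theorem SmoothSamples.taylor (hs : SmoothSamples F μ L) :
    ∀ᵐ ξ ∂μ, ∀ x y, |F y ξ - F x ξ - ⟪stochGrad F x ξ, y - x⟫| ≤ L / 2 * ‖y - x‖ ^ 2 := by
  filter_upwards [hs] with ξ hξ x y
  exact abs_sub_inner_gradient_le hξ.1 hξ.2 x y

/-- Measurability of the gradient is not assumed in the zeroth-order setting. Each coordinate is an
almost sure limit of measurable difference quotients, with error `L/(2(n+1))` by Taylor's estimate.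
-/
theorem SmoothSamples.aestronglyMeasurable_stochGrad (hs : SmoothSamples F μ L)
    (hF : Measurable (fun p : EuclideanSpace ℝ (Fin d) × Ξ => F p.1 p.2))
    (x : EuclideanSpace ℝ (Fin d)) : AEStronglyMeasurable (stochGrad F x) μ := by
  set B := EuclideanSpace.basisFun (Fin d) ℝ
  have hFx : ∀ w, Measurable (F w) := fun w => hF.comp measurable_prodMk_left
  have hcoord : ∀ i, AEMeasurable (fun ξ => ⟪B i, stochGrad F x ξ⟫) μ := fun i => by
    refine aemeasurable_of_tendsto_metrizable_ae Filter.atTop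
      (f := fun (n : ℕ) ξ => ((n : ℝ) + 1) * (F (x + ((n : ℝ) + 1)⁻¹ • B i) ξ - F x ξ))
      (fun n => (((hFx _).sub (hFx _)).const_mul _).aemeasurable) ?_
    filter_upwards [hs.taylor] with ξ hξ
    rw [tendsto_iff_norm_sub_tendsto_zero]
    have h0 : Filter.Tendsto (fun n : ℕ => L / 2 * (1 / ((n : ℝ) + 1))) Filter.atTop (nhds 0) := by
      simpa using tendsto_one_div_add_atTop_nhds_zero_nat.const_mul (L / 2)
    refine squeeze_zero (fun n => norm_nonneg _) (fun n => ?_) h0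
    have hn : (0 : ℝ) < (n : ℝ) + 1 := by positivity
    have h := hξ x (x + ((n : ℝ) + 1)⁻¹ • B i)
    rw [add_sub_cancel_left, inner_smul_right, norm_smul, B.norm_eq_one, mul_one,
      Real.norm_of_nonneg (by positivity), real_inner_comm] at h
    have e : ((n : ℝ) + 1) * (F (x + ((n : ℝ) + 1)⁻¹ • B i) ξ - F x ξ) - ⟪B i, stochGrad F x ξ⟫
        = ((n : ℝ) + 1) * (F (x + ((n : ℝ) + 1)⁻¹ • B i) ξ - F x ξ
          - ((n : ℝ) + 1)⁻¹ * ⟪B i, stochGrad F x ξ⟫) := by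
      field_simp
    rw [e, norm_mul, Real.norm_of_nonneg hn.le, Real.norm_eq_abs]
    refine (mul_le_mul_of_nonneg_left h hn.le).trans (le_of_eq ?_)
    field_simp
  have hsum : stochGrad F x = fun ξ => ∑ i, ⟪B i, stochGrad F x ξ⟫ • B i := by
    funext ξ
    exact (B.sum_repr' _).symm
  rw [hsum]
  exact (Finset.aemeasurable_fun_sum _ fun i _ =>
    (hcoord i).smul_const (B i)).aestronglyMeasurable

theorem integrable_of_integrable_norm_sq {α E : Type*} [MeasurableSpace α] [NormedAddCommGroup E]
    {P : Measure α} [IsFiniteMeasure P] {X : α → E} (hX : AEStronglyMeasurable X P)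
    (h2 : Integrable (fun a => ‖X a‖ ^ 2) P) : Integrable X P := by
  refine ((integrable_const (1 : ℝ)).add h2).mono' hX (Filter.Eventually.of_forall fun a => ?_)
  simp only [Pi.add_apply]
  nlinarith [sq_nonneg (‖X a‖ - 1), norm_nonneg (X a)]

/-- Differentiation under the integral sign. -/
theorem SmoothSamples.gradient_objective [IsProbabilityMeasure μ] (hs : SmoothSamples F μ L)
    (hFI : ∀ x, Integrable (F x) μ) {x : EuclideanSpace ℝ (Fin d)}
    (hv : Integrable (stochGrad F x) μ) :
    gradient (objective F μ) x = ∫ ξ, stochGrad F x ξ ∂μ := by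
  refine HasGradientAt.gradient (hasGradientAt_iff_isLittleO.2 ?_)
  -- The samplewise Taylor remainder is bounded uniformly in `ξ`, so it survives integration; no
  -- dominated convergence is needed.
  have hbig : (fun y => objective F μ y - objective F μ x
      - ⟪∫ ξ, stochGrad F x ξ ∂μ, y - x⟫) =O[nhds x] fun y => ‖y - x‖ ^ 2 := by
    refine Asymptotics.IsBigO.of_bound (L / 2) (Filter.Eventually.of_forall fun y => ?_)
    have hi : ⟪∫ ξ, stochGrad F x ξ ∂μ, y - x⟫ = ∫ ξ, ⟪stochGrad F x ξ, y - x⟫ ∂μ := by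
      rw [real_inner_comm, ← integral_inner hv]
      simp_rw [real_inner_comm]
    have hvI : Integrable (fun ξ => ⟪stochGrad F x ξ, y - x⟫) μ := hv.inner_const _
    have e : objective F μ y - objective F μ x - ⟪∫ ξ, stochGrad F x ξ ∂μ, y - x⟫
        = ∫ ξ, (F y ξ - F x ξ - ⟪stochGrad F x ξ, y - x⟫) ∂μ := by
      have hFF : Integrable (fun ξ => F y ξ - F x ξ) μ := (hFI y).sub (hFI x)
      rw [hi, objective, objective, integral_sub hFF hvI, integral_sub (hFI y) (hFI x)]
    rw [e, Real.norm_of_nonneg (sq_nonneg ‖y - x‖)]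
    refine (norm_integral_le_of_norm_le_const (C := L / 2 * ‖y - x‖ ^ 2) ?_).trans (by simp)
    filter_upwards [hs.taylor] with ξ hξ
    exact hξ x y
  exact hbig.trans_isLittleO (Asymptotics.isLittleO_pow_sub_sub x one_lt_two)

/-- The directional-derivative version of the smoothing estimator. -/
def directionalGrad (F : EuclideanSpace ℝ (Fin d) → Ξ → ℝ) (x : EuclideanSpace ℝ (Fin d))
    (r : Ξ × EuclideanSpace ℝ (Fin d)) : EuclideanSpace ℝ (Fin d) :=
  ⟪stochGrad F x r.1, r.2⟫ • r.2

theorem SmoothSamples.norm_zerothOrderGrad_sub_le [SFinite μ] (hs : SmoothSamples F μ L) {ν : ℝ}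
    (hν : 0 < ν) (x : EuclideanSpace ℝ (Fin d)) :
    ∀ᵐ r ∂(μ.prod (stdGaussian (EuclideanSpace ℝ (Fin d)))),
      ‖zerothOrderGrad F ν x r - directionalGrad F x r‖ ≤ L * ν / 2 * ‖r.2‖ ^ 3 := by
  have h := (Measure.quasiMeasurePreserving_fst (μ := μ)
    (ν := stdGaussian (EuclideanSpace ℝ (Fin d)))).ae hs.taylor
  filter_upwards [h] with r hr
  have h1 := hr x (x + ν • r.2)
  rw [add_sub_cancel_left, inner_smul_right, norm_smul, Real.norm_of_nonneg hν.le] at h1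
  rw [zerothOrderGrad, directionalGrad, ← sub_smul, norm_smul, Real.norm_eq_abs]
  have e : (F (x + ν • r.2) r.1 - F x r.1) / ν - ⟪stochGrad F x r.1, r.2⟫
      = (F (x + ν • r.2) r.1 - F x r.1 - ν * ⟪stochGrad F x r.1, r.2⟫) / ν := by
    field_simp
  rw [e, abs_div, abs_of_pos hν]
  calc _ ≤ L / 2 * (ν * ‖r.2‖) ^ 2 / ν * ‖r.2‖ := by gcongr
    _ = L * ν / 2 * ‖r.2‖ ^ 3 := by field_simp

theorem measurable_zerothOrderGrad
    (hF : Measurable (fun p : EuclideanSpace ℝ (Fin d) × Ξ => F p.1 p.2)) (ν : ℝ) :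
    Measurable (fun p : EuclideanSpace ℝ (Fin d) × (Ξ × EuclideanSpace ℝ (Fin d)) =>
      zerothOrderGrad F ν p.1 p.2) := by
  have h1 : Measurable (fun p : EuclideanSpace ℝ (Fin d) × (Ξ × EuclideanSpace ℝ (Fin d)) =>
      F (p.1 + ν • p.2.2) p.2.1) :=
    hF.comp (Measurable.prodMk (by fun_prop) (by fun_prop))
  have h2 : Measurable (fun p : EuclideanSpace ℝ (Fin d) × (Ξ × EuclideanSpace ℝ (Fin d)) =>
      F p.1 p.2.1) := hF.comp (Measurable.prodMk (by fun_prop) (by fun_prop))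
  exact ((h1.sub h2).div_const ν).smul (by fun_prop)

variable [IsProbabilityMeasure μ]

/-- Integrate over the Gaussian direction first, with `ξ` frozen: its identity covariance gives
unbiasedness, its fourth moments give the factor `d + 2`. -/
theorem directionalGrad_moments (x : EuclideanSpace ℝ (Fin d))
    (hm : AEStronglyMeasurable (stochGrad F x) μ)
    (h2 : Integrable (fun ξ => ‖stochGrad F x ξ‖ ^ 2) μ) :
    Integrable (directionalGrad F x) (μ.prod (stdGaussian (EuclideanSpace ℝ (Fin d)))) ∧
    ∫ r, directionalGrad F x r ∂(μ.prod (stdGaussian (EuclideanSpace ℝ (Fin d))))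
      = ∫ ξ, stochGrad F x ξ ∂μ ∧
    Integrable (fun r => ‖directionalGrad F x r‖ ^ 2)
      (μ.prod (stdGaussian (EuclideanSpace ℝ (Fin d)))) ∧
    ∫ r, ‖directionalGrad F x r‖ ^ 2 ∂(μ.prod (stdGaussian (EuclideanSpace ℝ (Fin d))))
      = (d + 2) * ∫ ξ, ‖stochGrad F x ξ‖ ^ 2 ∂μ := by
  set Q := μ.prod (stdGaussian (EuclideanSpace ℝ (Fin d))) with hQ
  have hdm : AEStronglyMeasurable (directionalGrad F x) Q :=
    ((hm.comp_fst).inner (𝕜 := ℝ) measurable_snd.aestronglyMeasurable).smul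
      measurable_snd.aestronglyMeasurable
  have hsq : ∀ r : Ξ × EuclideanSpace ℝ (Fin d),
      ‖directionalGrad F x r‖ ^ 2 = ⟪stochGrad F x r.1, r.2⟫ ^ 2 * ‖r.2‖ ^ 2 := fun r => by
    rw [directionalGrad, norm_smul, mul_pow, Real.norm_eq_abs, sq_abs]
  have h2I : Integrable (fun r => ‖directionalGrad F x r‖ ^ 2) Q := by
    have hnm : AEStronglyMeasurable (fun r => ‖directionalGrad F x r‖ ^ 2) Q := hdm.norm.pow 2
    refine (integrable_prod_iff hnm).2
      ⟨Filter.Eventually.of_forall fun ξ => ?_, ?_⟩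
    · simp_rw [hsq]
      exact integrable_inner_sq_mul_norm_sq _
    · simp_rw [norm_pow, norm_norm, hsq, integral_inner_sq_mul_norm_sq]
      exact h2.const_mul _
  have hI := integrable_of_integrable_norm_sq hdm h2I
  refine ⟨hI, ?_, h2I, ?_⟩
  · rw [integral_prod _ hI]
    simp_rw [directionalGrad, integral_inner_smul]
  · rw [integral_prod _ h2I]
    simp_rw [hsq, integral_inner_sq_mul_norm_sq]
    rw [integral_const_mul]

theorem integral_norm_sub_integral_sq_le {α E : Type*} [MeasurableSpace α] [NormedAddCommGroup E]
    [InnerProductSpace ℝ E] [CompleteSpace E] {P : Measure α} [IsProbabilityMeasure P] {X : α → E}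
    (hX : Integrable X P) (h2 : Integrable (fun a => ‖X a‖ ^ 2) P) :
    Integrable (fun a => ‖X a - ∫ a, X a ∂P‖ ^ 2) P ∧
      ∫ a, ‖X a - ∫ a, X a ∂P‖ ^ 2 ∂P ≤ ∫ a, ‖X a‖ ^ 2 ∂P := by
  set m := ∫ a, X a ∂P with hm
  have hi : Integrable (fun a => ⟪m, X a⟫) P := hX.const_inner m
  have e : ∀ a, ‖X a - m‖ ^ 2 = ‖X a‖ ^ 2 - 2 * ⟪m, X a⟫ + ‖m‖ ^ 2 := fun a => by
    rw [norm_sub_sq_real, real_inner_comm]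
  simp_rw [e]
  have h3 : Integrable (fun a => ‖X a‖ ^ 2 - 2 * ⟪m, X a⟫) P := h2.sub (hi.const_mul 2)
  refine ⟨h3.add (integrable_const _), ?_⟩
  rw [integral_add h3 (integrable_const _), integral_sub h2 (hi.const_mul 2), integral_const_mul,
    integral_inner hX, ← hm, real_inner_self_eq_norm_sq]
  simp only [integral_const, probReal_univ, one_smul]
  nlinarith [sq_nonneg ‖m‖]

/-- Bias and second moment of the Gaussian smoothing estimator. -/
theorem SmoothSamples.zerothOrderGrad_moments (hs : SmoothSamples F μ L)
    (hF : Measurable (fun p : EuclideanSpace ℝ (Fin d) × Ξ => F p.1 p.2))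
    (hFI : ∀ x, Integrable (F x) μ) (hL : 0 ≤ L) {ν w : ℝ} (hν : 0 < ν) (hw : 0 < w)
    (hdw : (d : ℝ) ^ 3 ≤ w ^ 2) {x : EuclideanSpace ℝ (Fin d)}
    (h2 : Integrable (fun ξ => ‖stochGrad F x ξ‖ ^ 2) μ) :
    Integrable (zerothOrderGrad F ν x) (μ.prod (stdGaussian (EuclideanSpace ℝ (Fin d)))) ∧
    ‖∫ r, zerothOrderGrad F ν x r ∂(μ.prod (stdGaussian (EuclideanSpace ℝ (Fin d))))
      - gradient (objective F μ) x‖ ≤ 2 * L * (ν * w) ∧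
    Integrable (fun r => ‖zerothOrderGrad F ν x r‖ ^ 2)
      (μ.prod (stdGaussian (EuclideanSpace ℝ (Fin d)))) ∧
    ∫ r, ‖zerothOrderGrad F ν x r‖ ^ 2 ∂(μ.prod (stdGaussian (EuclideanSpace ℝ (Fin d))))
      ≤ 2 * (d + 2) * ∫ ξ, ‖stochGrad F x ξ‖ ^ 2 ∂μ + 15 / 2 * L ^ 2 * (ν * w) ^ 2 := by
  have hvm := hs.aestronglyMeasurable_stochGrad hF x
  have hv := integrable_of_integrable_norm_sq hvm h2
  obtain ⟨hdI, hdint, hd2I, hd2⟩ := directionalGrad_moments x hvm h2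
  have hdiff := hs.norm_zerothOrderGrad_sub_le hν x
  set Q := μ.prod (stdGaussian (EuclideanSpace ℝ (Fin d))) with hQ
  have hzm : AEStronglyMeasurable (zerothOrderGrad F ν x) Q :=
    ((measurable_zerothOrderGrad hF ν).comp measurable_prodMk_left).aestronglyMeasurable
  have hpow : ∀ n : ℕ, Integrable
      (fun r : Ξ × EuclideanSpace ℝ (Fin d) => ‖r.2‖ ^ n) Q := fun n =>
    (integrable_norm_pow_stdGaussian n).comp_snd μ
  have hsix : ∫ r, ‖r.2‖ ^ 6 ∂Q ≤ 15 * w ^ 2 := by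
    have h := integral_fun_snd (μ := μ) (ν := stdGaussian (EuclideanSpace ℝ (Fin d)))
      (fun u : EuclideanSpace ℝ (Fin d) => ‖u‖ ^ 6)
    rw [probReal_univ, one_smul] at h
    rw [hQ, h]
    exact integral_norm_pow_six_le.trans (by linarith)
  have hthree : ∫ r, ‖r.2‖ ^ 3 ∂Q ≤ 4 * w := by
    -- AM-GM with equality at `‖u‖³ = 4w` reduces the third moment to the sixth. The result is `(2 +
    -- 15/8) w`, rounded up to `4w`.
    have hb : ∀ r : Ξ × EuclideanSpace ℝ (Fin d),
        ‖r.2‖ ^ 3 ≤ 2 * w + (8 * w)⁻¹ * ‖r.2‖ ^ 6 := fun r => by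
      have e : 2 * w + (8 * w)⁻¹ * ‖r.2‖ ^ 6 - ‖r.2‖ ^ 3
          = (8 * w)⁻¹ * (‖r.2‖ ^ 3 - 4 * w) ^ 2 := by
        field_simp; ring
      have : 0 ≤ (8 * w)⁻¹ * (‖r.2‖ ^ 3 - 4 * w) ^ 2 := by positivity
      linarith
    refine (integral_mono (hpow 3) ((integrable_const _).add ((hpow 6).const_mul _)) hb).trans ?_
    simp only [Pi.add_apply]
    rw [integral_add (integrable_const _) ((hpow 6).const_mul _), integral_const_mul (8 * w)⁻¹]
    simp only [integral_const, probReal_univ, one_smul]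
    have h4 := mul_le_mul_of_nonneg_left hsix (show 0 ≤ (8 * w)⁻¹ by positivity)
    have e : (8 * w)⁻¹ * (15 * w ^ 2) = 15 / 8 * w := by field_simp
    rw [e] at h4
    linarith
  have hsqb : ∀ᵐ r ∂Q, ‖zerothOrderGrad F ν x r‖ ^ 2
      ≤ 2 * ‖directionalGrad F x r‖ ^ 2 + L ^ 2 * ν ^ 2 / 2 * ‖r.2‖ ^ 6 := by
    filter_upwards [hdiff] with r hr
    have h3 : ‖zerothOrderGrad F ν x r‖
        ≤ ‖directionalGrad F x r‖ + L * ν / 2 * ‖r.2‖ ^ 3 := by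
      have := norm_sub_norm_le (zerothOrderGrad F ν x r) (directionalGrad F x r)
      linarith
    have h4 := pow_le_pow_left₀ (norm_nonneg _) h3 2
    nlinarith [sq_nonneg (‖directionalGrad F x r‖ - L * ν / 2 * ‖r.2‖ ^ 3)]
  have hbI : Integrable (fun r : Ξ × EuclideanSpace ℝ (Fin d) =>
      2 * ‖directionalGrad F x r‖ ^ 2 + L ^ 2 * ν ^ 2 / 2 * ‖r.2‖ ^ 6) Q :=
    (hd2I.const_mul 2).add ((hpow 6).const_mul _)
  have hz2I : Integrable (fun r => ‖zerothOrderGrad F ν x r‖ ^ 2) Q := by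
    refine hbI.mono' (hzm.norm.pow 2) ?_
    filter_upwards [hsqb] with r hr
    rwa [norm_pow, norm_norm]
  have hzI := integrable_of_integrable_norm_sq hzm hz2I
  refine ⟨hzI, ?_, hz2I, ?_⟩
  · rw [hs.gradient_objective hFI hv, ← hdint, ← integral_sub hzI hdI]
    refine (norm_integral_le_of_norm_le ((hpow 3).const_mul _) hdiff).trans ?_
    rw [integral_const_mul]
    have := mul_le_mul_of_nonneg_left hthree (show 0 ≤ L * ν / 2 by positivity)
    linarith
  · refine (integral_mono_ae hz2I hbI hsqb).trans ?_
    rw [integral_add (hd2I.const_mul 2) ((hpow 6).const_mul _), integral_const_mul,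
      integral_const_mul, hd2]
    have := mul_le_mul_of_nonneg_left hsix (show 0 ≤ L ^ 2 * ν ^ 2 / 2 by positivity)
    nlinarith

end ZerothOrder

/-! ### Sample counts and choice of the horizon -/

section Batches

theorem one_le_natCeil {r : ℝ} (hr : 0 < r) : 1 ≤ ⌈r⌉₊ := Nat.one_le_iff_ne_zero.2 (by
  simpa using hr)

theorem totalSamples_le {b : ℕ → ℕ} {a : ℝ} (ha : 0 ≤ a)
    (hb : ∀ t : ℕ, (b t : ℝ) ≤ a * (t * (t + 1)) + 1) (T : ℕ) :
    (totalSamples b T : ℝ) ≤ (2 * a + 1) * (T : ℝ) ^ 3 := by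
  have h : ∀ t ∈ Finset.Icc 1 T, (b t : ℝ) ≤ (2 * a + 1) * (T : ℝ) ^ 2 := by
    intro t ht
    obtain ⟨h1, h2⟩ := Finset.mem_Icc.1 ht
    have h1' : (1 : ℝ) ≤ t := by exact_mod_cast h1
    have h2' : (t : ℝ) ≤ T := by exact_mod_cast h2
    have h3 : (t : ℝ) * (t + 1) ≤ 2 * (T : ℝ) ^ 2 := by nlinarith
    have h4 := mul_le_mul_of_nonneg_left h3 ha
    have h5 : (1 : ℝ) ≤ (T : ℝ) ^ 2 := by nlinarith
    linarith [hb t]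
  rw [totalSamples, Nat.cast_sum]
  refine (Finset.sum_le_card_nsmul _ _ _ h).trans (le_of_eq ?_)
  simp only [Nat.card_Icc, Nat.add_sub_cancel, nsmul_eq_mul]
  ring

theorem natCeil_le_add_one {r s : ℝ} (hr : 0 ≤ r) (h : r = s) : (⌈r⌉₊ : ℝ) ≤ s + 1 :=
  h ▸ (Nat.ceil_lt_add_one hr).le

/-- A horizon proportional to the inverse square root of the accuracy. -/
theorem exists_horizon {c ε : ℝ} (hc : 0 ≤ c) (hε : 0 < ε) : ∃ T : ℕ,
    c ^ 2 / ((T : ℝ) + 1) ^ 2 ≤ ε ∧ (T : ℝ) ^ 2 ≤ c ^ 2 * ε ^ (-1 : ℝ) ∧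
      (T : ℝ) ^ 3 ≤ c ^ 3 * ε ^ (-(3 / 2) : ℝ) := by
  set r : ℝ := ε ^ (-(1 / 2) : ℝ) with hr
  have hr0 : 0 < r := Real.rpow_pos_of_pos hε _
  have h2 : r ^ 2 = ε ^ (-1 : ℝ) := by
    rw [hr, ← Real.rpow_natCast, ← Real.rpow_mul hε.le]; norm_num
  have h3 : r ^ 3 = ε ^ (-(3 / 2) : ℝ) := by
    rw [hr, ← Real.rpow_natCast, ← Real.rpow_mul hε.le]; norm_num
  have hcr : 0 ≤ c * r := by positivity
  -- Rounding down keeps the cost bounds without additive terms, even when `ε` is large and `T = 0`;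
  -- accuracy is then stated with `T + 1`, which exceeds `c * r`.
  refine ⟨⌊c * r⌋₊, ?_, ?_, ?_⟩
  · have h4 := (Nat.lt_floor_add_one (c * r)).le
    have h5 := pow_le_pow_left₀ hcr h4 2
    rw [div_le_iff₀ (by positivity)]
    rw [mul_pow, h2, Real.rpow_neg_one, ← div_eq_mul_inv, div_le_iff₀ hε] at h5
    linarith
  · rw [← h2, ← mul_pow]
    exact pow_le_pow_left₀ (by positivity) (Nat.floor_le hcr) 2
  · rw [← h3, ← mul_pow]
    exact pow_le_pow_left₀ (by positivity) (Nat.floor_le hcr) 3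

theorem rate_le_of_horizon {A B ε : ℝ} {T : ℕ} (hA : 0 ≤ A) (hB : 0 ≤ B)
    (h : (A + B) / ((T : ℝ) + 1) ^ 2 ≤ ε) :
    A / ((T : ℝ) + 2) ^ 2 + B / (((T : ℝ) + 1) * (T + 2)) ≤ ε := by
  refine le_trans ?_ h
  rw [add_div]
  have h1 : A / ((T : ℝ) + 2) ^ 2 ≤ A / ((T : ℝ) + 1) ^ 2 := by gcongr; norm_num
  have h2 : B / (((T : ℝ) + 1) * (T + 2)) ≤ B / ((T : ℝ) + 1) ^ 2 := by
    rw [sq]; gcongr; norm_num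
  linarith

end Batches

/-! ### Instantiating the rate for the two oracles -/

section Settings

variable {ρ L D : ℝ} {d : ℕ} {Ξ : Type u} [MeasurableSpace Ξ] {Ω : Type v} {mΩ : MeasurableSpace Ω}
  {K : Set (EuclideanSpace ℝ (Fin d))} {F : EuclideanSpace ℝ (Fin d) → Ξ → ℝ}
  {μ : Measure Ξ} [IsProbabilityMeasure μ] {xs : EuclideanSpace ℝ (Fin d)} {T : ℕ}
  {P : Measure Ω} [IsProbabilityMeasure P] {ℱ : Filtration ℕ mΩ}
  {x y z g : ℕ → Ω → EuclideanSpace ℝ (Fin d)} {p q : ℕ → ℕ → Ω → EuclideanSpace ℝ (Fin d)}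

theorem FirstOrderSetting.rate {s : (t : ℕ) → Fin (batchFO ρ t) → Ω → Ξ} (hρ : 0 < ρ) (hL : 0 < L)
    (hD : 0 < D) (h : FirstOrderSetting ρ L D K F μ xs T P ℱ s x y z g p q) {t : ℕ} (ht : t ≤ T) :
    Integrable (fun ω => objective F μ (x t ω) - objective F μ xs) P ∧
    ∫ ω, (objective F μ (x t ω) - objective F μ xs) ∂P
      ≤ 6 * L * D ^ 2 / ((t : ℝ) + 2) ^ 2
        + (15 * L * D ^ 2 + 3 * ‖gradient (objective F μ) xs‖ * D)
          / (((t : ℝ) + 1) * ((t : ℝ) + 2)) := by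
  rw [mul_assoc 3]
  -- No bias and no constant variance, so `e` is the bare `9/2`. With `lam = 15` and `κ = 10`, the
  -- condition `hlam` reads `10.5 (k-1)² + 9.5 ≥ 0`.
  refine h.run.rate hL hD h.problem h.solution h.oracle.measurable h.oracle.integrable (B := 0)
    (σ := 2 * ρ * L) (v := 0) (e := 9 / 2) (lam := 15) (κ := 10) le_rfl (fun w hw => ?_)
    (fun w hw => ?_) (fun t ht => ?_) (fun t => ?_) (fun t ht => ?_) (by norm_num) (by norm_num)
    (by norm_num) (fun k hk => ?_) ht
  · rw [h.oracle.unbiased w hw, sub_self, norm_zero]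
  · rw [h.oracle.unbiased w hw, add_zero]
    exact h.growth w hw
  · have : (1 : ℝ) ≤ t := by exact_mod_cast ht
    exact one_le_natCeil (by positivity)
  · have hb := Nat.le_ceil (3 * ρ * ((t + 1 : ℕ) : ℝ) * (((t + 1 : ℕ) : ℝ) + 1))
    have := mul_le_mul_of_nonneg_left hb (show 0 ≤ 2 * L by positivity)
    rw [batchFO]
    refine le_trans (le_of_eq ?_) this
    push_cast
    ring
  · simp
  · nlinarith [sq_nonneg ((k : ℝ) - 1)]

theorem ZerothOrderSetting.rate {s : (t : ℕ) → Fin (batchZO ρ d t) → Ω → Ξ × EuclideanSpace ℝ (Fin d)}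
    (hρ : 0 < ρ) (hL : 0 < L) (hD : 0 < D)
    (h : ZerothOrderSetting ρ L D K F μ xs T P ℱ s x y z g p q) {t : ℕ} (ht : t ≤ T) :
    Integrable (fun ω => objective F μ (x t ω) - objective F μ xs) P ∧
    ∫ ω, (objective F μ (x t ω) - objective F μ xs) ∂P
      ≤ 8 * L * D ^ 2 / ((t : ℝ) + 2) ^ 2
        + 32 * L * D ^ 2 / (((t : ℝ) + 1) * ((t : ℝ) + 2)) := by
  set w : ℝ := ((d : ℝ) + 6) ^ (3 / 2 : ℝ) with hw
  have hw0 : 0 < w := by positivity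
  have hw2 : w ^ 2 = ((d : ℝ) + 6) ^ 3 := by
    rw [hw, ← Real.rpow_natCast, ← Real.rpow_mul (by positivity), ← Real.rpow_natCast]
    norm_num
  have hdw : (d : ℝ) ^ 3 ≤ w ^ 2 := by
    rw [hw2]; gcongr; norm_num
  have hν : 0 < smoothingParam D d T := by unfold smoothingParam; positivity
  have hνw : smoothingParam D d T * w = D / ((T : ℝ) + 2) ^ 2 := by
    rw [smoothingParam, ← hw]; field_simp
  have hmom := fun r (hr : r ∈ K) => h.smooth.zerothOrderGrad_moments h.problem.measurable
    h.problem.integrable hL.le hν hw0 hdw (h.growth r hr).1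
  rw [hνw] at hmom
  -- At `x*` the moment condition has right-hand side `0`, so almost every stochastic gradient
  -- vanishes there.
  have hgrad : gradient (objective F μ) xs = 0 := by
    have hg := h.growth xs h.solution.mem
    have hv := integrable_of_integrable_norm_sq
      (h.smooth.aestronglyMeasurable_stochGrad h.problem.measurable xs) hg.1
    rw [h.smooth.gradient_objective h.problem.integrable hv]
    have h0 : ∫ ξ, ‖stochGrad F xs ξ‖ ^ 2 ∂μ = 0 :=
      le_antisymm (by simpa using hg.2) (integral_nonneg fun ξ => by positivity)
    have h1 := (integral_eq_zero_iff_of_nonneg (fun ξ => by positivity) hg.1).1 h0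
    refine integral_eq_zero_of_ae ?_
    filter_upwards [h1] with ξ hξ
    simpa using hξ
  have hrate := h.run.rate hL hD h.problem h.solution
    (measurable_zerothOrderGrad h.problem.measurable _) (fun r hr => (hmom r hr).1)
    -- Here `ν w = D/(T+2)²`, so bias and constant variance no longer depend on `d`. They contribute
    -- at most `6` and `15/4` to `e`, whence `57/4 = 9/2 + 6 + 15/4`.
    (B := 2 * L * (D / ((T : ℝ) + 2) ^ 2)) (σ := 4 * ρ * L * (d + 2))
    (v := 15 / 2 * L ^ 2 * (D / ((T : ℝ) + 2) ^ 2) ^ 2) (e := 57 / 4) (lam := 32) (κ := 17)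
    (by positivity) (fun r hr => (hmom r hr).2.1) (fun r hr => ?_) (fun t ht => ?_) (fun t => ?_)
    (fun t ht => ?_) (by norm_num) (by norm_num) (by norm_num) (fun k hk => ?_) ht
  · refine ⟨hrate.1, hrate.2.trans ?_⟩
    rw [hgrad, norm_zero, zero_mul, mul_zero, add_zero]
    gcongr
    norm_num
  · obtain ⟨h1, -, h2, h3⟩ := hmom r hr
    obtain ⟨h4, h5⟩ := integral_norm_sub_integral_sq_le h1 h2
    refine ⟨h4, (h5.trans h3).trans ?_⟩
    have := mul_le_mul_of_nonneg_left (h.growth r hr).2 (show 0 ≤ 2 * ((d : ℝ) + 2) by positivity)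
    linarith
  · have : (1 : ℝ) ≤ t := by exact_mod_cast ht
    exact one_le_natCeil (by positivity)
  · have hb := Nat.le_ceil (6 * ρ * ((d : ℝ) + 4) * ((t + 1 : ℕ) : ℝ) * (((t + 1 : ℕ) : ℝ) + 1))
    have hm := mul_le_mul_of_nonneg_left hb (show 0 ≤ 2 * L by positivity)
    rw [batchZO]
    refine le_trans ?_ hm
    push_cast
    have : 0 ≤ ρ * L * ((t : ℝ) + 1) * (t + 2) := by positivity
    linarith
  · have ht' : (t : ℝ) + 1 ≤ T := by exact_mod_cast ht
    have ht0 : (0 : ℝ) ≤ t := by positivity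
    have hT : (3 : ℝ) ≤ (T : ℝ) + 2 := by linarith
    have hTp : (0 : ℝ) < (T : ℝ) + 2 := by linarith
    have e1 : 3 * (15 / 2 * L ^ 2 * (D / ((T : ℝ) + 2) ^ 2) ^ 2) / (2 * L)
        = 45 / 4 * (L * D ^ 2) / ((T : ℝ) + 2) ^ 4 := by
      field_simp; ring
    have e2 : 3 * ((t : ℝ) + 1) * (t + 2) * (2 * L * (D / ((T : ℝ) + 2) ^ 2) * D)
        = 6 * (L * D ^ 2) * (((t + 1) * (t + 2)) / ((T : ℝ) + 2) ^ 2) := by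
      field_simp; ring
    have b2 : ((t : ℝ) + 1) * (t + 2) / ((T : ℝ) + 2) ^ 2 ≤ 1 := by
      rw [div_le_one (by positivity), sq]
      gcongr <;> linarith
    have b1 : ((t : ℝ) + 1) * (t + 2) * (t + 3) / ((T : ℝ) + 2) ^ 4 ≤ 1 / 3 := by
      rw [div_le_iff₀ (by positivity)]
      have : ((t : ℝ) + 1) * (t + 2) * (t + 3)
          ≤ ((T : ℝ) + 2) * ((T : ℝ) + 2) * ((T : ℝ) + 2) := by
        have a1 : (t : ℝ) + 1 ≤ T + 2 := by linarith
        have a2 : (t : ℝ) + 2 ≤ T + 2 := by linarith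
        have a3 : (t : ℝ) + 3 ≤ T + 2 := by linarith
        exact mul_le_mul (mul_le_mul a1 a2 (by positivity) hTp.le) a3 (by positivity)
          (by positivity)
      have h3 : ((T : ℝ) + 2) * ((T : ℝ) + 2) * ((T : ℝ) + 2) * 3
          ≤ ((T : ℝ) + 2) * ((T : ℝ) + 2) * ((T : ℝ) + 2) * ((T : ℝ) + 2) := by gcongr
      linarith
    rw [e1, e2]
    have hLD : 0 ≤ L * D ^ 2 := by positivity
    have c1 := mul_le_mul_of_nonneg_left b1 (show 0 ≤ 45 / 4 * (L * D ^ 2) by positivity)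
    have c2 := mul_le_mul_of_nonneg_left b2 (show 0 ≤ 6 * (L * D ^ 2) by positivity)
    have e3 : ((t : ℝ) + 1) * (t + 2) * (t + 3) * (45 / 4 * (L * D ^ 2) / ((T : ℝ) + 2) ^ 4)
        = 45 / 4 * (L * D ^ 2) * (((t : ℝ) + 1) * (t + 2) * (t + 3) / ((T : ℝ) + 2) ^ 4) := by
      ring
    rw [e3]
    linarith
  · nlinarith [sq_nonneg ((k : ℝ) - 1)]

end Settings

end

theorem theorem2 (ρ L D : ℝ) (hρ : 0 < ρ) (hL : 0 < L) (hD : 0 < D) :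
    -- (a) first-order oracle: termination of the inner loops and convergence rate
    (∀ {d : ℕ} {Ξ : Type u} [MeasurableSpace Ξ] {Ω : Type v} {mΩ : MeasurableSpace Ω}
      (K : Set (EuclideanSpace ℝ (Fin d))) (F : EuclideanSpace ℝ (Fin d) → Ξ → ℝ)
      (μ : Measure Ξ) [IsProbabilityMeasure μ] (xs : EuclideanSpace ℝ (Fin d)) (T : ℕ)
      (P : Measure Ω) [IsProbabilityMeasure P] (ℱ : Filtration ℕ mΩ)
      (s : (t : ℕ) → Fin (batchFO ρ t) → Ω → Ξ)
      (x y z g : ℕ → Ω → EuclideanSpace ℝ (Fin d))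
      (p q : ℕ → ℕ → Ω → EuclideanSpace ℝ (Fin d)),
      FirstOrderSetting ρ L D K F μ xs T P ℱ s x y z g p q →
      (∀ ω, InnerLoopsTerminate (scgsBeta L) (scgsEta L D) T y g p q ω) ∧
      ∀ t : ℕ, t ≤ T →
        Integrable (fun ω => objective F μ (x t ω) - objective F μ xs) P ∧
        ∫ ω, (objective F μ (x t ω) - objective F μ xs) ∂P
          ≤ 6 * L * D ^ 2 / ((t : ℝ) + 2) ^ 2
            + (15 * L * D ^ 2 + 3 * ‖gradient (objective F μ) xs‖ * D)
              / (((t : ℝ) + 1) * ((t : ℝ) + 2))) ∧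
    -- (a) oracle complexities; the constant depends only on ρ, L, D and a bound on ‖∇f(x*)‖
    (∀ M : ℝ, ∃ C : ℝ, 0 < C ∧ ∀ ε : ℝ, 0 < ε → ∃ T : ℕ,
      (totalSamples (batchFO ρ) T : ℝ) ≤ C * ε ^ (-(3 / 2) : ℝ) ∧
      ∀ {d : ℕ} {Ξ : Type u} [MeasurableSpace Ξ] {Ω : Type v} {mΩ : MeasurableSpace Ω}
        (K : Set (EuclideanSpace ℝ (Fin d))) (F : EuclideanSpace ℝ (Fin d) → Ξ → ℝ)
        (μ : Measure Ξ) [IsProbabilityMeasure μ] (xs : EuclideanSpace ℝ (Fin d))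
        (P : Measure Ω) [IsProbabilityMeasure P] (ℱ : Filtration ℕ mΩ)
        (s : (t : ℕ) → Fin (batchFO ρ t) → Ω → Ξ)
        (x y z g : ℕ → Ω → EuclideanSpace ℝ (Fin d))
        (p q : ℕ → ℕ → Ω → EuclideanSpace ℝ (Fin d)),
        FirstOrderSetting ρ L D K F μ xs T P ℱ s x y z g p q →
        ‖gradient (objective F μ) xs‖ ≤ M →
        (∫ ω, (objective F μ (x T ω) - objective F μ xs) ∂P ≤ ε) ∧
        ∀ ω, (lmoCalls (scgsBeta L) (scgsEta L D) T y g p q ω : ℝ) ≤ C * ε ^ (-1 : ℝ)) ∧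
    -- (b) zeroth-order oracle: termination of the inner loops and convergence rate
    (∀ {d : ℕ} {Ξ : Type u} [MeasurableSpace Ξ] {Ω : Type v} {mΩ : MeasurableSpace Ω}
      (K : Set (EuclideanSpace ℝ (Fin d))) (F : EuclideanSpace ℝ (Fin d) → Ξ → ℝ)
      (μ : Measure Ξ) [IsProbabilityMeasure μ] (xs : EuclideanSpace ℝ (Fin d)) (T : ℕ)
      (P : Measure Ω) [IsProbabilityMeasure P] (ℱ : Filtration ℕ mΩ)
      (s : (t : ℕ) → Fin (batchZO ρ d t) → Ω → Ξ × EuclideanSpace ℝ (Fin d))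
      (x y z g : ℕ → Ω → EuclideanSpace ℝ (Fin d))
      (p q : ℕ → ℕ → Ω → EuclideanSpace ℝ (Fin d)),
      ZerothOrderSetting ρ L D K F μ xs T P ℱ s x y z g p q →
      (∀ ω, InnerLoopsTerminate (scgsBeta L) (scgsEta L D) T y g p q ω) ∧
      ∀ t : ℕ, t ≤ T →
        Integrable (fun ω => objective F μ (x t ω) - objective F μ xs) P ∧
        ∫ ω, (objective F μ (x t ω) - objective F μ xs) ∂P
          ≤ 8 * L * D ^ 2 / ((t : ℝ) + 2) ^ 2
            + 32 * L * D ^ 2 / (((t : ℝ) + 1) * ((t : ℝ) + 2))) ∧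
    -- (b) oracle complexities (two calls per sample); the constant depends only on ρ, L, D
    (∃ C : ℝ, 0 < C ∧ ∀ ε : ℝ, 0 < ε → ∃ T : ℕ, ∀ d : ℕ, 1 ≤ d →
      (2 * totalSamples (batchZO ρ d) T : ℝ) ≤ C * d * ε ^ (-(3 / 2) : ℝ) ∧
      ∀ {Ξ : Type u} [MeasurableSpace Ξ] {Ω : Type v} {mΩ : MeasurableSpace Ω}
        (K : Set (EuclideanSpace ℝ (Fin d))) (F : EuclideanSpace ℝ (Fin d) → Ξ → ℝ)
        (μ : Measure Ξ) [IsProbabilityMeasure μ] (xs : EuclideanSpace ℝ (Fin d))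
        (P : Measure Ω) [IsProbabilityMeasure P] (ℱ : Filtration ℕ mΩ)
        (s : (t : ℕ) → Fin (batchZO ρ d t) → Ω → Ξ × EuclideanSpace ℝ (Fin d))
        (x y z g : ℕ → Ω → EuclideanSpace ℝ (Fin d))
        (p q : ℕ → ℕ → Ω → EuclideanSpace ℝ (Fin d)),
        ZerothOrderSetting ρ L D K F μ xs T P ℱ s x y z g p q →
        (∫ ω, (objective F μ (x T ω) - objective F μ xs) ∂P ≤ ε) ∧
        ∀ ω, (lmoCalls (scgsBeta L) (scgsEta L D) T y g p q ω : ℝ) ≤ C * ε ^ (-1 : ℝ)) := by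
  refine ⟨?_, ?_, ?_, ?_⟩
  · intro d Ξ _ Ω mΩ K F μ _ xs T P _ ℱ s x y z g p q h
    exact ⟨h.run.terminates hL hD h.problem.convex h.problem.diam_le,
      fun t ht => h.rate hρ hL hD ht⟩
  · intro M
    -- The sum of both numerators of the rate, so that `A/(T+1)²` dominates it. The absolute value
    -- keeps `A` positive for every `M`, because `C` must be produced even if no problem satisfies
    -- the bound.
    set A : ℝ := 6 * L * D ^ 2 + (15 * L * D ^ 2 + 3 * |M| * D) with hA
    have hA0 : 0 < A := by positivity
    have hc0 : 0 < √A := Real.sqrt_pos.2 hA0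
    refine ⟨(6 * ρ + 1) * √A ^ 3 + 16 * √A ^ 2, by positivity, fun ε hε => ?_⟩
    obtain ⟨T, h1, h2, h3⟩ := exists_horizon hc0.le hε
    have hr1 : 0 < ε ^ (-1 : ℝ) := Real.rpow_pos_of_pos hε _
    have hr2 : 0 < ε ^ (-(3 / 2) : ℝ) := Real.rpow_pos_of_pos hε _
    refine ⟨T, ?_, ?_⟩
    · have hb := totalSamples_le (b := batchFO ρ) (a := 3 * ρ) (by positivity)
        (fun t => natCeil_le_add_one (by positivity) (by ring)) T
      have := mul_le_mul_of_nonneg_left h3 (show 0 ≤ 2 * (3 * ρ) + 1 by positivity)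
      have h4 : 0 ≤ 16 * √A ^ 2 * ε ^ (-(3 / 2) : ℝ) := by positivity
      linarith
    · intro d Ξ _ Ω mΩ K F μ _ xs P _ ℱ s x y z g p q h hM
      refine ⟨(h.rate hρ hL hD le_rfl).2.trans ?_, fun ω => ?_⟩
      · have hgM := hM.trans (le_abs_self M)
        rw [Real.sq_sqrt hA0.le] at h1
        refine le_trans ?_ (rate_le_of_horizon (by positivity) (by positivity) h1)
        gcongr
      · have hl : (lmoCalls (scgsBeta L) (scgsEta L D) T y g p q ω : ℝ) ≤ 16 * (T : ℝ) ^ 2 := by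
          exact_mod_cast h.run.lmoCalls_le hL hD h.problem.convex h.problem.diam_le ω
        have h4 : 0 ≤ (6 * ρ + 1) * √A ^ 3 * ε ^ (-1 : ℝ) := by positivity
        linarith
  · intro d Ξ _ Ω mΩ K F μ _ xs T P _ ℱ s x y z g p q h
    exact ⟨h.run.terminates hL hD h.problem.convex h.problem.diam_le,
      fun t ht => h.rate hρ hL hD ht⟩
  · set A : ℝ := 8 * L * D ^ 2 + 32 * L * D ^ 2 with hA
    have hA0 : 0 < A := by positivity
    have hc0 : 0 < √A := Real.sqrt_pos.2 hA0
    refine ⟨(120 * ρ + 2) * √A ^ 3 + 16 * √A ^ 2, by positivity, fun ε hε => ?_⟩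
    obtain ⟨T, h1, h2, h3⟩ := exists_horizon hc0.le hε
    have hr1 : 0 < ε ^ (-1 : ℝ) := Real.rpow_pos_of_pos hε _
    have hr2 : 0 < ε ^ (-(3 / 2) : ℝ) := Real.rpow_pos_of_pos hε _
    refine ⟨T, fun d hd => ⟨?_, ?_⟩⟩
    · have hd' : (1 : ℝ) ≤ d := by exact_mod_cast hd
      have hb := totalSamples_le (b := batchZO ρ d) (a := 6 * ρ * (d + 4)) (by positivity)
        (fun t => natCeil_le_add_one (by positivity) (by ring)) T
      -- From `d + 4 ≤ 5d` and `1 ≤ d`; this is where positivity of the dimension is needed.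
      have hcoef : 2 * (2 * (6 * ρ * ((d : ℝ) + 4)) + 1) ≤ (120 * ρ + 2) * d := by nlinarith
      have h5 := mul_le_mul_of_nonneg_right hcoef (show (0 : ℝ) ≤ (T : ℝ) ^ 3 by positivity)
      have h6 := mul_le_mul_of_nonneg_left h3 (show 0 ≤ (120 * ρ + 2) * (d : ℝ) by positivity)
      have h4 : 0 ≤ 16 * √A ^ 2 * d * ε ^ (-(3 / 2) : ℝ) := by positivity
      linarith
    · intro Ξ _ Ω mΩ K F μ _ xs P _ ℱ s x y z g p q h
      refine ⟨(h.rate hρ hL hD le_rfl).2.trans ?_, fun ω => ?_⟩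
      · rw [Real.sq_sqrt hA0.le] at h1
        exact rate_le_of_horizon (by positivity) (by positivity) h1
      · have hl : (lmoCalls (scgsBeta L) (scgsEta L D) T y g p q ω : ℝ) ≤ 16 * (T : ℝ) ^ 2 := by
          exact_mod_cast h.run.lmoCalls_le hL hD h.problem.convex h.problem.diam_le ω
        have h4 : 0 ≤ (120 * ρ + 2) * √A ^ 3 * ε ^ (-1 : ℝ) := by positivity
        linarith
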